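/- **Notation.** $\|g\|=(\int_0^1|g(x)|^2dx)^{1/2}$; $u[t]=u(t,\cdot)$; a prime is the derivative in $x$. $H^1(0,1)$ is the space of absolutely continuous functions on $[0,1]$ with square integrable derivative. $PC^1([0,1])$ is the set of continuous functions on $[0,1]$ that have finite one-sided derivatives everywhere and are continuously differentiable on $(0,1)$ off a finite set. A *time sequence* is a strictly increasing sequence $\tau_0=0<\tau_1<\tau_2<\cdots$ with $\tau_i\to+\infty$; put $I=[0,+\infty)\setminus\{\tau_i: i\ge 0\}$. Let $p>0$, $q\in\mathbb R$, $(Ag)(x)=-pg''(x)+qg(x)$. **Class GD.** Let $D$ be the set of $g\in H^2(0,1)$ satisfying the Dirichlet conditions $g(0)=g(1)=0$ (respectively the Neumann conditions $g'(0)=g'(1)=0$). A function $f:[0,+\infty)\times[0,1]\to\mathbb R$ is of class GD with the time sequence $(\tau_i)$, for Dirichlet (respectively Neumann) conditions, if for every $i\ge1$ there are $f_1,f_2\in C^0((\tau_{i-1},\tau_i)\times[0,1])$, $a\in PC^1([0,1])$, $b\in C^0([0,1])$, $c\in D\cap C^2([0,1])$ such that for all $t\in(\tau_{i-1},\tau_i)$: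 $f_1[t]\in PC^1([0,1])$, $f_2[t]\in D\cap C^2([0,1])$, $f[t]=f_1[t]+f_2[t]$; moreover $$\sup_{\tau_{i-1}<t<\tau_i}\int_0^1\big(|f_1(t,x)|^2+|f_2(t,x)|^2+|(Af_2[t])(x)|^2\big)dx<+\infty ,$$ $\partial f_1/\partial t$ exists and is continuous on $(\tau_{i-1},\tau_i)\times[0,1]$, and $f_1(t,x)\to a(x)$, $\frac{\partial f_1}{\partial t}(t,x)\to b(x)$, $f_2(t,x)\to c(x)$ as $t\to\tau_i^-$, for every $x\in[0,1]$. **Class GB.** A right continuous $d:[0,+\infty)\to\mathbb R$ is of class GB if there is a time sequence such that $d\in C^2(I)$, the left limits of $d,\dot d,\ddot d$ at each $\tau_i>0$ are finite, and $\dot d$ is bounded on each $(\tau_i,\tau_{i+1})$. **Solution.** Let $f$ be of class GD with the time sequence $(\tau_i)$, for Dirichlet conditions. A solution of $$\frac{\partial u}{\partial t}=p\frac{\partial^2u}{\partial x^2}-qu+f,\qquad u(t,0)=u(t,1)=0,\qquad u[0]=u_0$$ is a function $u:[0,+\infty)\times[0,1]\to\mathbb R$ with $u\in C^0([0,+\infty);L^2(0,1))$,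 $u\in C^1(I\times[0,1])$, $u[t]\in C^2([0,1])$ for all $t>0$, such that for all $i\ge1$ and $x\in[0,1]$, as $t\to\tau_i^-$, $u(t,x)\to u(\tau_i,x)$, $u'(t,x)\to u'(\tau_i,x)$ and $\frac{\partial u}{\partial t}(t,x)\to-(Au[\tau_i])(x)+\lim_{s\to\tau_i^-}f(s,x)$, such that $u(0,x)=u_0(x)$ for all $x\in[0,1]$, the equation holds on $I\times(0,1)$, and the boundary conditions hold for $t\in I$. **Theorem 2.7.** Let $p>0$ and $q>-p\pi^2$. Let $u_0\in H^1(0,1)$ with $u_0(0)=u_0(1)=0$. Let $f$ be of class GD for Dirichlet conditions, with $f[t]\in C^1([0,1])$ for all $t\ge0$, with $f'$ of class GD (for Dirichlet or for Neumann conditions), and with $t\mapsto f(t,0)$, $t\mapsto f(t,1)$ of class GB. Then a solution $u$ of the above problem satisfies, for all $\sigma\in[0,p\pi^2+q)$ and $t>0$ (the suprema being finite), $$\|u[t]\|\le e^{-(p\pi^2+q)t}\|u_0\|+\frac{1}{p\pi^2+q-\sigma}\sup_{0<s<t}\big(\|f[s]\|e^{-\sigma(t-s)}\big),$$ $$\|u'[t]\|\le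 e^{-(p\pi^2+q)t}\|u_0'\|+\frac{p\pi^2+q}{p\pi^2+q-\sigma}\,p^{-1}h(q/p)\sup_{0<s<t}\big(\|f[s]\|e^{-\sigma(t-s)}\big),$$ where $$h(s)=\begin{cases}\dfrac{\sqrt{e^{2\sqrt s}-e^{-2\sqrt s}-4\sqrt s}}{2s^{1/4}(e^{\sqrt s}-e^{-\sqrt s})}&s>0,\\[2mm]\dfrac{\sqrt6}{6}&s=0,\\[2mm]\dfrac{\sqrt{4\sqrt{-s}-2\sin(2\sqrt{-s})}}{4(-s)^{1/4}\sin(\sqrt{-s})}&-\pi^2<s<0.\end{cases}$$ -/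

import Mathlib

open Set Filter Topology MeasureTheory

noncomputable section

namespace ParabolicSL

/-- The norm `‖g‖ = (∫₀¹ |g(x)|² dx)^{1/2}` of `L²(0,1)`. -/
def l2norm (g : ℝ → ℝ) : ℝ :=
  Real.sqrt (∫ x in (0 : ℝ)..1, |g x| ^ 2)

/-- The norm `‖g‖_r = (∫₀¹ r(x) |g(x)|² dx)^{1/2}` of the weighted space `L²_r(0,1)`. -/
def weightedNorm (r g : ℝ → ℝ) : ℝ :=
  Real.sqrt (∫ x in (0 : ℝ)..1, r x * |g x| ^ 2)

/-- The profile `g` lies in `L²(0,1)`. For a weight that is continuous and positive on `[0,1]`,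
`L²_r(0,1)` is the same set of functions. -/
def MemL2 (g : ℝ → ℝ) : Prop :=
  MemLp g 2 (volume.restrict (Ioo (0 : ℝ) 1))

/-- `H¹(0,1)`: absolutely continuous functions on `[0,1]` whose (a.e. defined) derivative is
square integrable. -/
def MemH1 (w : ℝ → ℝ) : Prop :=
  AbsolutelyContinuousOnInterval w 0 1 ∧ MemL2 (deriv w)

/-- The spatial derivative `f'(t,x)` on `[0,1]` (one-sided at the end points). -/
def spatialDeriv (f : ℝ → ℝ → ℝ) : ℝ → ℝ → ℝ :=
  fun t x => derivWithin (f t) (Icc 0 1) x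

/-- The class `PC¹([0,1])` of continuous, piecewise `C¹` functions. -/
structure IsPC1 (g : ℝ → ℝ) : Prop where
  continuousOn : ContinuousOn g (Icc 0 1)
  right : ∀ x ∈ Ico (0 : ℝ) 1, ∃ l, HasDerivWithinAt g l (Ioi x) x
  left : ∀ x ∈ Ioc (0 : ℝ) 1, ∃ l, HasDerivWithinAt g l (Iio x) x
  piecewise : ∃ S : Set ℝ, S.Finite ∧ S ⊆ Ioo 0 1 ∧
    (∀ x ∈ Ioo (0 : ℝ) 1 \ S, DifferentiableAt ℝ g x) ∧
    ContinuousOn (deriv g) (Ioo 0 1 \ S)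

/-- The data of a regular Sturm-Liouville operator on `[0,1]`: coefficients `p, r, q` and the
boundary conditions `b₁ g(0) + b₂ g'(0) = 0 = a₁ g(1) + a₂ g'(1)`. -/
structure SLOperator where
  p : ℝ → ℝ
  r : ℝ → ℝ
  q : ℝ → ℝ
  a₁ : ℝ
  a₂ : ℝ
  b₁ : ℝ
  b₂ : ℝ
  p_smooth : ContDiffOn ℝ 1 p (Icc 0 1)
  p_pos : ∀ x ∈ Icc (0 : ℝ) 1, 0 < p x
  r_cont : ContinuousOn r (Icc 0 1)
  r_pos : ∀ x ∈ Icc (0 : ℝ) 1, 0 < r x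
  q_cont : ContinuousOn q (Icc 0 1)
  a_ne : 0 < |a₁| + |a₂|
  b_ne : 0 < |b₁| + |b₂|

namespace SLOperator

/-- `(A g)(x) = -(1/r(x)) (p g')'(x) + (q(x)/r(x)) g(x)`. -/
def apply (A : SLOperator) (g : ℝ → ℝ) (x : ℝ) : ℝ :=
  -(1 / A.r x) * derivWithin (fun y => A.p y * derivWithin g (Icc 0 1) y) (Icc 0 1) x
    + A.q x / A.r x * g x

/-- The boundary functional `b₁ g(0) + b₂ g'(0)`. -/
def bdry0 (A : SLOperator) (g : ℝ → ℝ) : ℝ :=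
  A.b₁ * g 0 + A.b₂ * derivWithin g (Icc 0 1) 0

/-- The boundary functional `a₁ g(1) + a₂ g'(1)`. -/
def bdry1 (A : SLOperator) (g : ℝ → ℝ) : ℝ :=
  A.a₁ * g 1 + A.a₂ * derivWithin g (Icc 0 1) 1

/-- `g ∈ D ∩ C²([0,1])`, where `D ⊆ H²(0,1)` is the domain of `A`, that is, the set of functions
in `H²(0,1)` that satisfy the homogeneous boundary conditions. -/
def MemDomC2 (A : SLOperator) (g : ℝ → ℝ) : Prop :=
  ContDiffOn ℝ 2 g (Icc 0 1) ∧ A.bdry0 g = 0 ∧ A.bdry1 g = 0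

end SLOperator

/-- An increasing sequence of times with `τ₀ = 0` and `τᵢ → +∞`. -/
def IsTimeSeq (τ : ℕ → ℝ) : Prop :=
  StrictMono τ ∧ τ 0 = 0 ∧ Tendsto τ atTop atTop

/-- `I = [0,+∞) \ {τᵢ : i = 0,1,2,…}`. -/
def regularTimes (τ : ℕ → ℝ) : Set ℝ :=
  Ici 0 \ range τ

/-- The decomposition `f = f₁ + f₂` on the strip `(s, T) × [0,1]` that the class `GD` requires. -/
structure IsGDOn (A : SLOperator) (s T : ℝ) (f f₁ f₂ : ℝ → ℝ → ℝ) (a b c : ℝ → ℝ) : Prop where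
  f₁_cont : ContinuousOn (fun z : ℝ × ℝ => f₁ z.1 z.2) (Ioo s T ×ˢ Icc 0 1)
  f₂_cont : ContinuousOn (fun z : ℝ × ℝ => f₂ z.1 z.2) (Ioo s T ×ˢ Icc 0 1)
  a_pc1 : IsPC1 a
  b_cont : ContinuousOn b (Icc 0 1)
  c_dom : A.MemDomC2 c
  f₁_pc1 : ∀ t ∈ Ioo s T, IsPC1 (f₁ t)
  f₂_dom : ∀ t ∈ Ioo s T, A.MemDomC2 (f₂ t)
  sum_eq : ∀ t ∈ Ioo s T, ∀ x ∈ Icc (0 : ℝ) 1, f t x = f₁ t x + f₂ t x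
  bound : ∃ M : ℝ, ∀ t ∈ Ioo s T,
    ∫ x in (0 : ℝ)..1, A.r x * (|f₁ t x| ^ 2 + |f₂ t x| ^ 2 + |A.apply (f₂ t) x| ^ 2) ≤ M
  dt_exists : ∀ t ∈ Ioo s T, ∀ x ∈ Icc (0 : ℝ) 1, DifferentiableAt ℝ (fun t' => f₁ t' x) t
  dt_cont : ContinuousOn (fun z : ℝ × ℝ => deriv (fun t' => f₁ t' z.2) z.1)
    (Ioo s T ×ˢ Icc 0 1)
  lim_f₁ : ∀ x ∈ Icc (0 : ℝ) 1, Tendsto (fun t => f₁ t x) (𝓝[<] T) (𝓝 (a x))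
  lim_dt : ∀ x ∈ Icc (0 : ℝ) 1,
    Tendsto (fun t => deriv (fun t' => f₁ t' x) t) (𝓝[<] T) (𝓝 (b x))
  lim_f₂ : ∀ x ∈ Icc (0 : ℝ) 1, Tendsto (fun t => f₂ t x) (𝓝[<] T) (𝓝 (c x))

/-- `f` is of class `GD` (for the operator `A`) with the sequence of times `τ`. -/
def IsGDWith (A : SLOperator) (τ : ℕ → ℝ) (f : ℝ → ℝ → ℝ) : Prop :=
  IsTimeSeq τ ∧ ∀ i : ℕ, ∃ (f₁ f₂ : ℝ → ℝ → ℝ) (a b c : ℝ → ℝ),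
    IsGDOn A (τ i) (τ (i + 1)) f f₁ f₂ a b c

/-- The class `GD` of distributed inputs on `[0,+∞) × [0,1]`, for the operator `A`. -/
def IsGD (A : SLOperator) (f : ℝ → ℝ → ℝ) : Prop :=
  ∃ τ, IsGDWith A τ f

/-- The class `GB` of boundary inputs on `[0,+∞)`. -/
def IsGB (d : ℝ → ℝ) : Prop :=
  (∀ t, 0 ≤ t → ContinuousWithinAt d (Ici t) t) ∧
  ∃ τ, IsTimeSeq τ ∧
    ContDiffOn ℝ 2 d (regularTimes τ) ∧
    (∀ i, 0 < τ i →
      (∃ l, Tendsto d (𝓝[<] τ i) (𝓝 l)) ∧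
      (∃ l, Tendsto (deriv d) (𝓝[<] τ i) (𝓝 l)) ∧
      (∃ l, Tendsto (deriv (deriv d)) (𝓝[<] τ i) (𝓝 l))) ∧
    (∀ i, ∃ M, ∀ t ∈ Ioo (τ i) (τ (i + 1)), |deriv d t| ≤ M)

/-- `u` is a solution of the evolution equation
`∂u/∂t + A u = f`, `b₁ u(t,0) + b₂ u'(t,0) = d₀(t)`, `a₁ u(t,1) + a₂ u'(t,1) = d₁(t)`
with `u[0] = u₀`, for the sequence of times `τ` of the inputs. -/
structure IsSolution (A : SLOperator) (τ : ℕ → ℝ) (f : ℝ → ℝ → ℝ) (d₀ d₁ : ℝ → ℝ) (u₀ : ℝ → ℝ)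
    (u : ℝ → ℝ → ℝ) : Prop where
  memL2 : ∀ t, 0 ≤ t → MemL2 (u t)
  contL2 : ∀ t, 0 ≤ t →
    Tendsto (fun s => weightedNorm A.r (fun x => u s x - u t x)) (𝓝[Ici 0] t) (𝓝 0)
  contDiff : ContDiffOn ℝ 1 (fun z : ℝ × ℝ => u z.1 z.2) (regularTimes τ ×ˢ Icc 0 1)
  profile : ∀ t, 0 < t → ContDiffOn ℝ 2 (u t) (Icc 0 1)
  lim_u : ∀ i, 1 ≤ i → ∀ x ∈ Icc (0 : ℝ) 1,
    Tendsto (fun t => u t x) (𝓝[<] τ i) (𝓝 (u (τ i) x))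
  lim_dt : ∀ i, 1 ≤ i → ∀ x ∈ Icc (0 : ℝ) 1, ∃ l,
    Tendsto (fun t => f t x) (𝓝[<] τ i) (𝓝 l) ∧
    Tendsto (fun t => deriv (fun t' => u t' x) t) (𝓝[<] τ i) (𝓝 (-A.apply (u (τ i)) x + l))
  lim_dx : ∀ i, 1 ≤ i → ∀ x ∈ Icc (0 : ℝ) 1,
    Tendsto (fun t => spatialDeriv u t x) (𝓝[<] τ i) (𝓝 (spatialDeriv u (τ i) x))
  init : ∀ x ∈ Icc (0 : ℝ) 1, u 0 x = u₀ x
  pde : ∀ t ∈ regularTimes τ, ∀ x ∈ Ioo (0 : ℝ) 1,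
    deriv (fun t' => u t' x) t + A.apply (u t) x = f t x
  bc0 : ∀ t ∈ regularTimes τ, A.bdry0 (u t) - d₀ t = 0
  bc1 : ∀ t ∈ regularTimes τ, A.bdry1 (u t) - d₁ t = 0

/-- Constant coefficients `p, q`, `r ≡ 1` and Dirichlet conditions `g(0) = g(1) = 0`. -/
def dirichletOp (p q : ℝ) (hp : 0 < p) : SLOperator where
  p := fun _ => p
  r := fun _ => 1
  q := fun _ => q
  a₁ := 1
  a₂ := 0
  b₁ := 1
  b₂ := 0
  p_smooth := contDiffOn_const
  p_pos := fun _ _ => hp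
  r_cont := continuousOn_const
  r_pos := fun _ _ => one_pos
  q_cont := continuousOn_const
  a_ne := by norm_num
  b_ne := by norm_num

/-- Constant coefficients `p, q`, `r ≡ 1` and Neumann conditions `g'(0) = g'(1) = 0`. -/
def neumannOp (p q : ℝ) (hp : 0 < p) : SLOperator where
  p := fun _ => p
  r := fun _ => 1
  q := fun _ => q
  a₁ := 0
  a₂ := 1
  b₁ := 0
  b₂ := 1
  p_smooth := contDiffOn_const
  p_pos := fun _ _ => hp
  r_cont := continuousOn_const
  r_pos := fun _ _ => one_pos
  q_cont := continuousOn_const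
  a_ne := by norm_num
  b_ne := by norm_num

/-- The gain function `h`, meant for arguments `s > -π²`. -/
def gain (s : ℝ) : ℝ :=
  if 0 < s then
    Real.sqrt (Real.exp (2 * Real.sqrt s) - Real.exp (-(2 * Real.sqrt s)) - 4 * Real.sqrt s) /
      (2 * s ^ (1 / 4 : ℝ) * (Real.exp (Real.sqrt s) - Real.exp (-Real.sqrt s)))
  else if s = 0 then Real.sqrt 6 / 6
  else
    Real.sqrt (4 * Real.sqrt (-s) - 2 * Real.sin (2 * Real.sqrt (-s))) /
      (4 * (-s) ^ (1 / 4 : ℝ) * Real.sin (Real.sqrt (-s)))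

/-- The quantities `‖f[s]‖ exp(-σ(t-s))`, `0 < s < t`. -/
def fadingValues (f : ℝ → ℝ → ℝ) (σ t : ℝ) : Set ℝ :=
  (fun s => l2norm (f s) * Real.exp (-σ * (t - s))) '' Ioo 0 t

end ParabolicSL

end

/-! The Dirichlet operator is diagonal in the orthonormal basis `√2 sin(nπx)`, n ≥ 1, with
eigenvalues λ_n = p(nπ)² + q ≥ λ₁ = pπ² + q > 0. The n-th coefficient of u satisfies the scalar
equation y' = -λ_n y + f_n off the times τ_i and is continuous across them, so variation of
constants splits it into e^{-λ_n t} times the initial coefficient and a forced coefficient. Write S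
for the supremum in the theorem, so that ‖f[s]‖ ≤ S e^{σ(t-s)}.

By Parseval and Minkowski, each norm of u[t] is at most the norm of the free part, which decays like
e^{-λ₁t}, plus that of the forced part. For ‖u‖ the forced sequence is tested against itself
(`sum_forcedCoeff_sq_le`), which gives S/(λ₁ - σ).

The coefficients of u' in the cosine basis are nπ times those of u. Each forced coefficient is at
most S/(λ_n - σ) ≤ λ₁/(λ₁ - σ) · S/λ_n (`abs_forcedCoeff_le`), so the sum of (nπ/λ_n)² remains to be
bounded. The numbers nπ/((nπ)² + s), s = q/p, are the sine integrals of the solution of g'' = sg,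
g(0) = 1, g(1) = 0, and ∫g² = 2h(s)² in closed form (`sum_le_gain_sq`). -/

namespace ParabolicSL

/-! ### Parseval's identity for sine and cosine series -/

/-- The reflection of `g|_(0,1)` to `(-1,1)`: even for `ε = 1`, odd for `ε = -1`. -/
noncomputable def reflected (ε : ℝ) (g : ℝ → ℝ) (x : ℝ) : ℝ :=
  (Ioo (0 : ℝ) 1).indicator g x + ε * (Ioo (0 : ℝ) 1).indicator g (-x)

theorem memLp_reflected (ε : ℝ) {g : ℝ → ℝ} (hg : MemL2 g) :
    MemLp (reflected ε g) 2 volume := by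
  have h := (memLp_indicator_iff_restrict (μ := volume) (f := g) (p := 2)
    (measurableSet_Ioo (a := (0 : ℝ)) (b := 1))).2 hg
  have h' := (h.comp_measurePreserving (Measure.measurePreserving_neg volume)).const_mul ε
  exact h.add h'

theorem reflected_of_mem (ε : ℝ) (g : ℝ → ℝ) {x : ℝ} (hx : x ∈ Ioo (0 : ℝ) 1) :
    reflected ε g x = g x := by
  have : -x ∉ Ioo (0 : ℝ) 1 := fun h => by linarith [h.1, hx.1]
  simp [reflected, hx, indicator_of_notMem this]

theorem reflected_neg_of_mem (ε : ℝ) (g : ℝ → ℝ) {x : ℝ} (hx : x ∈ Ioo (0 : ℝ) 1) :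
    reflected ε g (-x) = ε * g x := by
  have : -x ∉ Ioo (0 : ℝ) 1 := fun h => by linarith [h.1, hx.1]
  simp [reflected, hx, indicator_of_notMem this]

theorem intervalIntegral_symm_eq {F : ℝ → ℂ} (hF : IntervalIntegrable F volume (-1) 1) :
    ∫ x in (-1 : ℝ)..1, F x = ∫ x in (0 : ℝ)..1, (F x + F (-x)) := by
  have h1 : IntervalIntegrable F volume (-1) 0 :=
    hF.mono_set (by rw [uIcc_of_le, uIcc_of_le] <;> [apply Icc_subset_Icc; skip; skip] <;> norm_num)
  have h2 : IntervalIntegrable F volume 0 1 :=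
    hF.mono_set (by rw [uIcc_of_le, uIcc_of_le] <;> [apply Icc_subset_Icc; skip; skip] <;> norm_num)
  have h3 : IntervalIntegrable (fun x => F (-x)) volume 0 1 := by
    have := h1.comp_sub_left 0
    simpa using this.symm
  rw [intervalIntegral.integral_add h2 h3, intervalIntegral.integral_comp_neg,
    ← intervalIntegral.integral_add_adjacent_intervals h1 h2, neg_zero, add_comm]

/-- End points are null sets; the reflection and the differential equation give information only on
the open interval. -/
theorem integral_zero_one_congr {E : Type*} [NormedAddCommGroup E] [NormedSpace ℝ E]
    {f g : ℝ → E} (h : ∀ x ∈ Ioo (0 : ℝ) 1, f x = g x) :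
    ∫ x in (0 : ℝ)..1, f x = ∫ x in (0 : ℝ)..1, g x := by
  rw [intervalIntegral.integral_of_le zero_le_one, intervalIntegral.integral_of_le zero_le_one,
    integral_Ioc_eq_integral_Ioo, integral_Ioc_eq_integral_Ioo]
  exact setIntegral_congr_fun measurableSet_Ioo h

/-- Folding (-1,1) onto (0,1) pairs the two exponentials: they combine to a sine for ε = -1 and to a
cosine for ε = 1. -/
theorem fourierCoeffOn_reflected (ε : ℝ) {g : ℝ → ℝ} (hg : MemL2 g) (n : ℤ) :
    fourierCoeffOn (show (-1 : ℝ) < 1 by norm_num) (fun x => (reflected ε g x : ℂ)) n =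
      (1 / 2 : ℂ) * ∫ x in (0 : ℝ)..1,
        (Complex.exp (-(n * Real.pi * x * Complex.I)) +
          ε * Complex.exp (n * Real.pi * x * Complex.I)) * g x := by
  have hint : IntervalIntegrable (fun x => (reflected ε g x : ℂ)) volume (-1) 1 := by
    rw [intervalIntegrable_iff_integrableOn_Ioc_of_le (by norm_num)]
    exact (((memLp_reflected ε hg).restrict _).integrable (by norm_num)).ofReal
  have hexp : ∀ x : ℝ, (fourier (-n) (x : AddCircle ((1 : ℝ) - -1)) : ℂ) =
      Complex.exp (-(n * Real.pi * x * Complex.I)) := by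
    intro x
    rw [fourier_coe_apply]
    congr 1
    push_cast
    ring
  rw [fourierCoeffOn_eq_integral]
  simp only [hexp, smul_eq_mul]
  rw [intervalIntegral_symm_eq]
  · rw [integral_zero_one_congr (g := fun x => (Complex.exp (-(n * Real.pi * x * Complex.I)) +
          ε * Complex.exp (n * Real.pi * x * Complex.I)) * g x)]
    · rw [Complex.real_smul]
      norm_num
    · intro x hx
      rw [reflected_of_mem ε g hx, reflected_neg_of_mem ε g hx]
      push_cast
      rw [mul_neg, neg_mul, neg_neg]
      ring
  · exact hint.continuousOn_mul (by fun_prop)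

/-- The Fourier sine integral of `g` on `(0,1)`. -/
noncomputable def sinCoeff (g : ℝ → ℝ) (n : ℕ) : ℝ :=
  ∫ x in (0 : ℝ)..1, g x * Real.sin (n * Real.pi * x)

/-- The Fourier cosine integral of `g` on `(0,1)`. -/
noncomputable def cosCoeff (g : ℝ → ℝ) (n : ℕ) : ℝ :=
  ∫ x in (0 : ℝ)..1, g x * Real.cos (n * Real.pi * x)

/-- Parseval needs only the modulus, which is the same at n and -n; the sum over ℤ can then be
folded onto ℕ. -/
theorem norm_fourierCoeffOn_reflected_odd {g : ℝ → ℝ} (hg : MemL2 g) (m : ℤ) (n : ℕ)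
    (h : m = n ∨ m = -n) :
    ‖fourierCoeffOn (show (-1 : ℝ) < 1 by norm_num) (fun x => (reflected (-1) g x : ℂ)) m‖ =
      |sinCoeff g n| := by
  have key : fourierCoeffOn (show (-1 : ℝ) < 1 by norm_num)
      (fun x => (reflected (-1) g x : ℂ)) m =
      -Complex.I * ((∫ x in (0 : ℝ)..1, g x * Real.sin (m * Real.pi * x) : ℝ) : ℂ) := by
    rw [fourierCoeffOn_reflected _ hg, ← intervalIntegral.integral_ofReal,
      ← intervalIntegral.integral_const_mul, ← intervalIntegral.integral_const_mul]
    congr 1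
    ext x
    push_cast
    rw [Complex.sin]
    rw [show (-(m * Real.pi * x) * Complex.I : ℂ) = -(m * Real.pi * x * Complex.I) by ring]
    linear_combination ((g x : ℂ) / 2 * (Complex.exp (-(m * Real.pi * x * Complex.I)) -
      Complex.exp (m * Real.pi * x * Complex.I))) * Complex.I_sq
  rw [key, norm_mul, norm_neg, Complex.norm_I, one_mul, Complex.norm_real, Real.norm_eq_abs]
  rcases h with rfl | rfl
  · simp [sinCoeff]
  · simp [sinCoeff, Real.sin_neg, intervalIntegral.integral_neg]

theorem norm_fourierCoeffOn_reflected_even {g : ℝ → ℝ} (hg : MemL2 g) (m : ℤ) (n : ℕ)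
    (h : m = n ∨ m = -n) :
    ‖fourierCoeffOn (show (-1 : ℝ) < 1 by norm_num) (fun x => (reflected 1 g x : ℂ)) m‖ =
      |cosCoeff g n| := by
  have key : fourierCoeffOn (show (-1 : ℝ) < 1 by norm_num)
      (fun x => (reflected 1 g x : ℂ)) m =
      ((∫ x in (0 : ℝ)..1, g x * Real.cos (m * Real.pi * x) : ℝ) : ℂ) := by
    rw [fourierCoeffOn_reflected _ hg, ← intervalIntegral.integral_ofReal,
      ← intervalIntegral.integral_const_mul]
    congr 1
    ext x
    push_cast
    rw [Complex.cos]
    rw [show (-(m * Real.pi * x) * Complex.I : ℂ) = -(m * Real.pi * x * Complex.I) by ring]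
    ring
  rw [key, Complex.norm_real, Real.norm_eq_abs]
  rcases h with rfl | rfl
  · simp [cosCoeff]
  · simp [cosCoeff]

theorem integral_sq_reflected {ε : ℝ} (hε : ε ^ 2 = 1) {g : ℝ → ℝ} (hg : MemL2 g) :
    ∫ x in (-1 : ℝ)..1, ‖(reflected ε g x : ℂ)‖ ^ 2 = 2 * ∫ x in (0 : ℝ)..1, |g x| ^ 2 := by
  have hint : IntervalIntegrable (fun x => ((reflected ε g x ^ 2 : ℝ) : ℂ)) volume (-1) 1 := by
    rw [intervalIntegrable_iff_integrableOn_Ioc_of_le (by norm_num)]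
    exact ((memLp_reflected ε hg).restrict _).integrable_sq.ofReal
  have h := intervalIntegral_symm_eq hint
  rw [integral_zero_one_congr (g := fun x => ((2 * |g x| ^ 2 : ℝ) : ℂ))] at h
  · rw [intervalIntegral.integral_ofReal, intervalIntegral.integral_ofReal] at h
    rw [← intervalIntegral.integral_const_mul]
    simpa using Complex.ofReal_injective h
  · intro x hx
    rw [reflected_of_mem ε g hx, reflected_neg_of_mem ε g hx, ← Complex.ofReal_add, mul_pow, hε,
      sq_abs]
    ring_nf

theorem hasSum_sq_reflected {ε : ℝ} (hε : ε ^ 2 = 1) {g : ℝ → ℝ} (hg : MemL2 g) :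
    HasSum (fun m : ℤ => ‖fourierCoeffOn (show (-1 : ℝ) < 1 by norm_num)
      (fun x => (reflected ε g x : ℂ)) m‖ ^ 2) (∫ x in (0 : ℝ)..1, |g x| ^ 2) := by
  have h := hasSum_sq_fourierCoeffOn (show (-1 : ℝ) < 1 by norm_num)
    (f := fun x => (reflected ε g x : ℂ)) ((memLp_reflected ε hg).restrict _).ofReal
  rw [integral_sq_reflected hε hg] at h
  -- The factor 1/2 from the length of (-1,1) cancels the doubling of the integral.
  convert h using 1
  rw [smul_eq_mul]
  ring

theorem l2norm_nonneg (g : ℝ → ℝ) : 0 ≤ l2norm g := Real.sqrt_nonneg _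

theorem l2norm_sq (g : ℝ → ℝ) : l2norm g ^ 2 = ∫ x in (0 : ℝ)..1, |g x| ^ 2 :=
  Real.sq_sqrt (intervalIntegral.integral_nonneg zero_le_one fun _ _ => by positivity)

/-- Parseval's identity for the sine series. -/
theorem hasSum_sinCoeff_sq {g : ℝ → ℝ} (hg : MemL2 g) :
    HasSum (fun n : ℕ => 2 * sinCoeff g (n + 1) ^ 2) (l2norm g ^ 2) := by
  -- Folding ℤ onto ℕ counts the index 0 twice; this is harmless because that coefficient vanishes.
  have h := (hasSum_sq_reflected (ε := -1) (by norm_num) hg).nat_add_neg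
  have h0 : sinCoeff g 0 = 0 := by simp [sinCoeff]
  rw [norm_fourierCoeffOn_reflected_odd hg 0 0 (by simp), h0, ← l2norm_sq] at h
  rw [hasSum_nat_add_iff (f := fun n => 2 * sinCoeff g n ^ 2) 1]
  simp only [fun n : ℕ => norm_fourierCoeffOn_reflected_odd hg n n (Or.inl rfl),
    fun n : ℕ => norm_fourierCoeffOn_reflected_odd hg (-n) n (Or.inr rfl), sq_abs, ← two_mul] at h
  simpa [h0] using h

/-- Parseval's identity for the cosine series of a function of mean zero. -/
theorem hasSum_cosCoeff_sq {g : ℝ → ℝ} (hg : MemL2 g) (h0 : cosCoeff g 0 = 0) :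
    HasSum (fun n : ℕ => 2 * cosCoeff g (n + 1) ^ 2) (l2norm g ^ 2) := by
  have h := (hasSum_sq_reflected (ε := 1) (by norm_num) hg).nat_add_neg
  rw [norm_fourierCoeffOn_reflected_even hg 0 0 (by simp), h0, ← l2norm_sq] at h
  rw [hasSum_nat_add_iff (f := fun n => 2 * cosCoeff g n ^ 2) 1]
  simp only [fun n : ℕ => norm_fourierCoeffOn_reflected_even hg n n (Or.inl rfl),
    fun n : ℕ => norm_fourierCoeffOn_reflected_even hg (-n) n (Or.inr rfl), sq_abs, ← two_mul] at h
  simpa [h0] using h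

/-! ### Sine and cosine integrals, integration by parts -/

theorem memL2_of_continuousOn {g : ℝ → ℝ} (hg : ContinuousOn g (Icc 0 1)) : MemL2 g := by
  obtain ⟨C, hC⟩ := isCompact_Icc.exists_bound_of_continuousOn hg
  refine MemLp.of_bound
    ((hg.mono Ioo_subset_Icc_self).aestronglyMeasurable measurableSet_Ioo) C ?_
  filter_upwards [ae_restrict_mem measurableSet_Ioo] with x hx
  exact hC x (Ioo_subset_Icc_self hx)

theorem MemL2.intervalIntegrable {g : ℝ → ℝ} (hg : MemL2 g) :
    IntervalIntegrable g volume 0 1 := by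
  rw [intervalIntegrable_iff_integrableOn_Ioo_of_le zero_le_one]
  exact hg.integrable (by norm_num)

theorem sinCoeff_congr {f g : ℝ → ℝ} (h : ∀ x ∈ Ioo (0 : ℝ) 1, f x = g x) (n : ℕ) :
    sinCoeff f n = sinCoeff g n :=
  integral_zero_one_congr fun x hx => by rw [h x hx]

theorem sinCoeff_add {f g : ℝ → ℝ} (hf : MemL2 f) (hg : MemL2 g) (n : ℕ) :
    sinCoeff (fun x => f x + g x) n = sinCoeff f n + sinCoeff g n := by
  unfold sinCoeff
  rw [← intervalIntegral.integral_add
    (hf.intervalIntegrable.mul_continuousOn (by fun_prop))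
    (hg.intervalIntegrable.mul_continuousOn (by fun_prop))]
  simp only [add_mul]

theorem sinCoeff_const_mul (c : ℝ) (g : ℝ → ℝ) (n : ℕ) :
    sinCoeff (fun x => c * g x) n = c * sinCoeff g n := by
  unfold sinCoeff
  rw [← intervalIntegral.integral_const_mul]
  simp only [mul_assoc]

theorem sinCoeff_sub {f g : ℝ → ℝ} (hf : MemL2 f) (hg : MemL2 g) (n : ℕ) :
    sinCoeff (fun x => f x - g x) n = sinCoeff f n - sinCoeff g n := by
  have h := sinCoeff_add hf (hg.const_mul (-1)) n
  rw [sinCoeff_const_mul] at h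
  rw [sub_eq_add_neg, ← neg_one_mul, ← h]
  simp only [neg_one_mul, ← sub_eq_add_neg]

theorem sin_natCast_mul_pi_mul_one (n : ℕ) : Real.sin (n * Real.pi * 1) = 0 := by
  rw [mul_one, Real.sin_nat_mul_pi]

theorem hasDerivAt_sin_mul (n : ℕ) (x : ℝ) :
    HasDerivAt (fun x : ℝ => Real.sin (n * Real.pi * x))
      (n * Real.pi * Real.cos (n * Real.pi * x)) x := by
  have := ((hasDerivAt_id x).const_mul (n * Real.pi)).sin
  simpa [mul_comm] using this

theorem hasDerivAt_cos_mul (n : ℕ) (x : ℝ) :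
    HasDerivAt (fun x : ℝ => Real.cos (n * Real.pi * x))
      (-(n * Real.pi * Real.sin (n * Real.pi * x))) x := by
  have := ((hasDerivAt_id x).const_mul (n * Real.pi)).cos
  simpa [mul_comm] using this

/-- Integration by parts against `sin (n π x)`, which vanishes at both end points. -/
theorem sinCoeff_deriv {g g' : ℝ → ℝ} (n : ℕ)
    (hg : ∀ x ∈ Icc (0 : ℝ) 1, HasDerivWithinAt g (g' x) (Icc 0 1) x)
    (hg' : ContinuousOn g' (Icc 0 1)) :
    sinCoeff g' n = -(n * Real.pi * cosCoeff g n) := by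
  have h := intervalIntegral.integral_mul_deriv_eq_deriv_mul_of_hasDerivWithinAt
    (a := 0) (b := 1) (u := fun x => Real.sin (n * Real.pi * x)) (v := g) (v' := g')
    (fun x _ => (hasDerivAt_sin_mul n x).hasDerivWithinAt)
    (by rwa [uIcc_of_le zero_le_one])
    (Continuous.intervalIntegrable (by fun_prop) _ _)
    (memL2_of_continuousOn hg').intervalIntegrable
  rw [sin_natCast_mul_pi_mul_one, mul_zero, Real.sin_zero] at h
  rw [sinCoeff, cosCoeff, ← intervalIntegral.integral_const_mul]
  simp only [mul_comm (g' _), h, zero_mul, sub_zero, zero_sub]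
  congr 2
  ext x
  ring

/-- Integration by parts against `cos (n π x)`, for a function that vanishes at `1`. -/
theorem cosCoeff_deriv {g g' : ℝ → ℝ} (n : ℕ)
    (hg : ∀ x ∈ Icc (0 : ℝ) 1, HasDerivWithinAt g (g' x) (Icc 0 1) x)
    (hg' : ContinuousOn g' (Icc 0 1)) (h1 : g 1 = 0) :
    cosCoeff g' n = -g 0 + n * Real.pi * sinCoeff g n := by
  have h := intervalIntegral.integral_mul_deriv_eq_deriv_mul_of_hasDerivWithinAt
    (a := 0) (b := 1) (u := fun x => Real.cos (n * Real.pi * x)) (v := g) (v' := g')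
    (fun x _ => (hasDerivAt_cos_mul n x).hasDerivWithinAt)
    (by rwa [uIcc_of_le zero_le_one])
    (Continuous.intervalIntegrable (by fun_prop) _ _)
    (memL2_of_continuousOn hg').intervalIntegrable
  rw [h1, mul_zero, mul_zero, Real.cos_zero] at h
  rw [sinCoeff, cosCoeff, ← intervalIntegral.integral_const_mul]
  simp only [mul_comm (g' _), h, one_mul, zero_sub]
  rw [sub_eq_add_neg, ← intervalIntegral.integral_neg]
  congr 2
  ext x
  ring

/-- Integration by parts against `cos (n π x)`, for an absolutely continuous function that
vanishes at both end points. -/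
theorem cosCoeff_deriv_of_absolutelyContinuous {g : ℝ → ℝ} (n : ℕ)
    (hg : AbsolutelyContinuousOnInterval g 0 1) (h0 : g 0 = 0) (h1 : g 1 = 0) :
    cosCoeff (deriv g) n = n * Real.pi * sinCoeff g n := by
  have hc : AbsolutelyContinuousOnInterval (fun x : ℝ => Real.cos (n * Real.pi * x)) 0 1 :=
    ContDiffOn.absolutelyContinuousOnInterval (by fun_prop)
  have h := hc.integral_mul_deriv_eq_deriv_mul hg
  rw [h0, h1, mul_zero, mul_zero, sub_zero, zero_sub] at h
  rw [sinCoeff, cosCoeff, ← intervalIntegral.integral_const_mul]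
  simp only [mul_comm (deriv g _), h, (hasDerivAt_cos_mul n _).deriv]
  rw [← intervalIntegral.integral_neg]
  congr 1
  ext x
  ring

/-! ### The gain function as an L² norm -/

/-- Bessel's inequality for the solution of `g'' = s g`, `g 0 = 1`, `g 1 = 0`. -/
theorem sum_resolvent_sq_le {s : ℝ} (hs : -Real.pi ^ 2 < s) {g g' : ℝ → ℝ}
    (hg : ∀ x, HasDerivAt g (g' x) x) (hg' : ∀ x, HasDerivAt g' (s * g x) x)
    (h0 : g 0 = 1) (h1 : g 1 = 0) (I : Finset ℕ) :
    ∑ n ∈ I, 2 * ((n + 1 : ℕ) * Real.pi / (((n + 1 : ℕ) * Real.pi) ^ 2 + s)) ^ 2 ≤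
      ∫ x in (0 : ℝ)..1, g x ^ 2 := by
  have cg : Continuous g := continuous_iff_continuousAt.2 fun x => (hg x).continuousAt
  have cg' : Continuous g' := continuous_iff_continuousAt.2 fun x => (hg' x).continuousAt
  have hP := hasSum_sinCoeff_sq (memL2_of_continuousOn cg.continuousOn)
  have hcoeff : ∀ n : ℕ, sinCoeff g (n + 1) =
      (n + 1 : ℕ) * Real.pi / (((n + 1 : ℕ) * Real.pi) ^ 2 + s) := by
    intro n
    -- Two integrations by parts of g'' = sg; the boundary value g(0) = 1 survives. With k = (n+1)π
    -- and c the sine integral of g, sc = k - k²c.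
    have e1 := sinCoeff_deriv (n + 1) (fun x _ => (hg' x).hasDerivWithinAt)
      (by fun_prop)
    have e2 := cosCoeff_deriv (n + 1) (fun x _ => (hg x).hasDerivWithinAt)
      cg'.continuousOn h1
    rw [sinCoeff_const_mul, e2, h0] at e1
    have hn : Real.pi ^ 2 ≤ ((n + 1 : ℕ) * Real.pi) ^ 2 := by
      have : (1 : ℝ) ≤ (n + 1 : ℕ) := by simp
      rw [mul_pow]
      exact le_mul_of_one_le_left (by positivity) (one_le_pow₀ this)
    rw [eq_div_iff (by linarith)]
    linear_combination e1
  have hle := sum_le_hasSum I (fun n _ => by positivity) hP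
  simp only [hcoeff, l2norm_sq, sq_abs] at hle
  exact hle

theorem gain_nonneg {s : ℝ} (hs : -Real.pi ^ 2 < s) : 0 ≤ gain s := by
  unfold gain
  split_ifs with h1 h2
  · have : 0 ≤ Real.exp √s - Real.exp (-√s) :=
      sub_nonneg.2 (Real.exp_le_exp.2 (by linarith [Real.sqrt_nonneg s]))
    positivity
  · positivity
  · have : 0 ≤ Real.sin √(-s) := Real.sin_nonneg_of_nonneg_of_le_pi (Real.sqrt_nonneg _)
      ((Real.sqrt_le_left Real.pi_pos.le).2 (by linarith))
    have : 0 ≤ -s := by linarith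
    positivity

/-- The right side is the integral of (sinh(ω(1-x))/sinh ω)² over (0,1). Putting s = ω² removes the
roots from the formula. -/
theorem gain_sq_of_pos {ω : ℝ} (hω : 0 < ω) :
    2 * gain (ω ^ 2) ^ 2 = (Real.sinh (2 * ω) / (4 * ω) - 1 / 2) / Real.sinh ω ^ 2 := by
  have hs : 0 < ω ^ 2 := by positivity
  have h4 : ((ω ^ 2 : ℝ) ^ (1 / 4 : ℝ)) ^ 2 = ω := by
    rw [← Real.rpow_natCast, ← Real.rpow_mul hs.le, ← Real.rpow_natCast, ← Real.rpow_mul hω.le]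
    norm_num
  have hsh : 0 < Real.sinh ω := Real.sinh_pos_iff.2 hω
  have e1 : Real.exp (2 * ω) - Real.exp (-(2 * ω)) - 4 * ω = 2 * (Real.sinh (2 * ω) - 2 * ω) := by
    rw [Real.sinh_eq]; ring
  have e2 : Real.exp ω - Real.exp (-ω) = 2 * Real.sinh ω := by
    rw [Real.sinh_eq]; ring
  have hnn : 0 ≤ 2 * (Real.sinh (2 * ω) - 2 * ω) := by
    have := Real.self_le_sinh_iff.2 (show 0 ≤ 2 * ω by positivity)
    linarith
  rw [gain, if_pos hs, Real.sqrt_sq hω.le, e1, e2, div_pow, mul_pow, mul_pow, h4,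
    Real.sq_sqrt hnn]
  field_simp
  ring

theorem gain_sq_of_neg {ω : ℝ} (hω : 0 < ω) (hπ : ω < Real.pi) :
    2 * gain (-ω ^ 2) ^ 2 = (1 / 2 - Real.sin (2 * ω) / (4 * ω)) / Real.sin ω ^ 2 := by
  have hs : 0 < ω ^ 2 := by positivity
  have h4 : ((ω ^ 2 : ℝ) ^ (1 / 4 : ℝ)) ^ 2 = ω := by
    rw [← Real.rpow_natCast, ← Real.rpow_mul hs.le, ← Real.rpow_natCast, ← Real.rpow_mul hω.le]
    norm_num
  have hsh : 0 < Real.sin ω := Real.sin_pos_of_pos_of_lt_pi hω hπ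
  have hnn : 0 ≤ 4 * ω - 2 * Real.sin (2 * ω) := by
    have := Real.sin_le (show 0 ≤ 2 * ω by positivity)
    linarith
  rw [gain, if_neg (by linarith), if_neg (by linarith), neg_neg, Real.sqrt_sq hω.le, div_pow,
    mul_pow, mul_pow, h4, Real.sq_sqrt hnn]
  field_simp
  ring

theorem hasDerivAt_mul_one_sub (ω x : ℝ) : HasDerivAt (fun x : ℝ => ω * (1 - x)) (-ω) x := by
  simpa using ((hasDerivAt_id x).const_sub 1).const_mul ω

theorem integral_sinh_sq {ω : ℝ} (hω : 0 < ω) :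
    ∫ x in (0 : ℝ)..1, Real.sinh (ω * (1 - x)) ^ 2 = Real.sinh (2 * ω) / (4 * ω) - 1 / 2 := by
  have h : ∀ x : ℝ, HasDerivAt (fun x => -(Real.sinh (2 * ω * (1 - x)) / (4 * ω)) + (1 - x) / 2)
      (Real.sinh (ω * (1 - x)) ^ 2) x := by
    intro x
    have := (((hasDerivAt_mul_one_sub (2 * ω) x).sinh.div_const (4 * ω)).neg).add
      (((hasDerivAt_id x).const_sub 1).div_const 2)
    refine this.congr_deriv ?_
    have hc : Real.cosh (2 * ω * (1 - x)) = 2 * Real.sinh (ω * (1 - x)) ^ 2 + 1 := by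
      rw [mul_assoc, Real.cosh_two_mul, Real.cosh_sq]; ring
    rw [hc]
    field_simp
    ring
  rw [intervalIntegral.integral_eq_sub_of_hasDerivAt (fun x _ => h x)
    (Continuous.intervalIntegrable (by fun_prop) _ _)]
  simp
  ring

theorem integral_sin_sq_mul {ω : ℝ} (hω : 0 < ω) :
    ∫ x in (0 : ℝ)..1, Real.sin (ω * (1 - x)) ^ 2 = 1 / 2 - Real.sin (2 * ω) / (4 * ω) := by
  have h : ∀ x : ℝ, HasDerivAt (fun x => Real.sin (2 * ω * (1 - x)) / (4 * ω) - (1 - x) / 2)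
      (Real.sin (ω * (1 - x)) ^ 2) x := by
    intro x
    have := (((hasDerivAt_mul_one_sub (2 * ω) x).sin.div_const (4 * ω))).sub
      (((hasDerivAt_id x).const_sub 1).div_const 2)
    refine this.congr_deriv ?_
    have hc : Real.cos (2 * ω * (1 - x)) = 1 - 2 * Real.sin (ω * (1 - x)) ^ 2 := by
      rw [mul_assoc, Real.cos_two_mul, Real.cos_sq']; ring
    rw [hc]
    field_simp
    ring
  rw [intervalIntegral.integral_eq_sub_of_hasDerivAt (fun x _ => h x)
    (Continuous.intervalIntegrable (by fun_prop) _ _)]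
  simp

/-- The boundary value problem g'' = sg, g(0) = 1, g(1) = 0 has an explicit solution in each case: a
quotient of sines for s < 0, 1 - x for s = 0, a quotient of hyperbolic sines for s > 0. Its squared
norm is 2h(s)². -/
theorem sum_le_gain_sq {s : ℝ} (hs : -Real.pi ^ 2 < s) (I : Finset ℕ) :
    ∑ n ∈ I, ((n + 1 : ℕ) * Real.pi / (((n + 1 : ℕ) * Real.pi) ^ 2 + s)) ^ 2 ≤ gain s ^ 2 := by
  suffices h : ∑ n ∈ I, 2 * ((n + 1 : ℕ) * Real.pi / (((n + 1 : ℕ) * Real.pi) ^ 2 + s)) ^ 2 ≤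
      2 * gain s ^ 2 by
    rw [← Finset.mul_sum] at h
    linarith
  rcases lt_trichotomy s 0 with h | h | h
  · obtain ⟨ω, hω, rfl⟩ : ∃ ω : ℝ, 0 < ω ∧ s = -ω ^ 2 :=
      ⟨√(-s), Real.sqrt_pos.2 (by linarith), by rw [Real.sq_sqrt (by linarith)]; ring⟩
    -- This is where s > -π² enters: sin ω does not vanish, so g can be normalised.
    have hπ : ω < Real.pi := lt_of_pow_lt_pow_left₀ 2 Real.pi_pos.le (by linarith)
    have hsin : Real.sin ω ≠ 0 := (Real.sin_pos_of_pos_of_lt_pi hω hπ).ne'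
    refine (sum_resolvent_sq_le hs (g := fun x => Real.sin (ω * (1 - x)) / Real.sin ω)
      (fun x => (hasDerivAt_mul_one_sub ω x).sin.div_const _)
      (fun x => ?_) (by simp [hsin]) (by simp) I).trans_eq ?_
    · refine (((hasDerivAt_mul_one_sub ω x).cos.mul_const (-ω)).div_const
        (Real.sin ω)).congr_deriv ?_
      ring
    · simp only [div_pow]
      rw [intervalIntegral.integral_div, integral_sin_sq_mul hω, gain_sq_of_neg hω hπ]
  · subst h
    refine (sum_resolvent_sq_le hs (g := fun x => 1 * (1 - x)) (g' := fun _ => -1)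
      (fun x => hasDerivAt_mul_one_sub 1 x)
      (fun x => by simpa using hasDerivAt_const x (-1 : ℝ)) (by simp) (by simp) I).trans_eq ?_
    have h : ∀ x : ℝ, HasDerivAt (fun x => -((1 - x) ^ 3 / 3)) ((1 * (1 - x)) ^ 2) x := by
      intro x
      refine ((((hasDerivAt_id x).const_sub 1).pow 3).div_const 3).neg.congr_deriv ?_
      simp
      ring
    rw [intervalIntegral.integral_eq_sub_of_hasDerivAt (fun x _ => h x)
      (Continuous.intervalIntegrable (by fun_prop) _ _)]
    rw [gain, if_neg (lt_irrefl _), if_pos rfl, div_pow, Real.sq_sqrt (by norm_num)]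
    norm_num
  · obtain ⟨ω, hω, rfl⟩ : ∃ ω : ℝ, 0 < ω ∧ s = ω ^ 2 :=
      ⟨√s, Real.sqrt_pos.2 h, by rw [Real.sq_sqrt h.le]⟩
    have hsinh : Real.sinh ω ≠ 0 := (Real.sinh_pos_iff.2 hω).ne'
    refine (sum_resolvent_sq_le hs (g := fun x => Real.sinh (ω * (1 - x)) / Real.sinh ω)
      (fun x => (hasDerivAt_mul_one_sub ω x).sinh.div_const _)
      (fun x => ?_) (by simp [hsinh]) (by simp) I).trans_eq ?_
    · refine (((hasDerivAt_mul_one_sub ω x).cosh.mul_const (-ω)).div_const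
        (Real.sinh ω)).congr_deriv ?_
      ring
    · simp only [div_pow]
      rw [intervalIntegral.integral_div, integral_sinh_sq hω, gain_sq_of_pos hω]

/-! ### Regularity in time -/

/-- A mean value inequality with an exponentially fading bound on the derivative, which may fail
to exist on a countable set. -/
theorem abs_sub_le_of_abs_deriv_le_exp {v v' : ℝ → ℝ} {C : Set ℝ} (hC : C.Countable) {t K μ : ℝ}
    (ht : 0 ≤ t) (hK : 0 ≤ K) (hμ : 0 < μ) (hv : ContinuousOn v (Icc 0 t))
    (hd : ∀ s ∈ Ioo 0 t \ C, HasDerivAt v (v' s) s)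
    (hb : ∀ s ∈ Ioo 0 t \ C, |v' s| ≤ K * Real.exp (-μ * (t - s))) :
    |v t - v 0| ≤ K / μ := by
  have hB : ∀ s : ℝ, HasDerivAt (fun s => K / μ * Real.exp (-μ * (t - s)))
      (K * Real.exp (-μ * (t - s))) s := by
    intro s
    refine ((((hasDerivAt_id s).const_sub t).const_mul (-μ)).exp.const_mul (K / μ)).congr_deriv ?_
    simp only [id]
    field_simp
  have hBint : IntervalIntegrable (fun s => K * Real.exp (-μ * (t - s))) volume 0 t :=
    Continuous.intervalIntegrable (by fun_prop) _ _
  have hae : ∀ᵐ s ∂volume.restrict (Ioc 0 t), ‖deriv v s‖ ≤ K * Real.exp (-μ * (t - s)) := by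
    -- The end point t joins the exceptional set because the bound is known only on the open
    -- interval.
    have h1 : ∀ᵐ s ∂volume, s ∉ insert t C :=
      (measure_eq_zero_iff_ae_notMem).1 ((hC.insert t).measure_zero _)
    filter_upwards [ae_restrict_of_ae h1, ae_restrict_mem measurableSet_Ioc] with s hs hs'
    simp only [mem_insert_iff, not_or] at hs
    have hm : s ∈ Ioo 0 t \ C := ⟨⟨hs'.1, lt_of_le_of_ne hs'.2 hs.1⟩, hs.2⟩
    rw [(hd s hm).deriv]
    exact hb s hm
  -- No continuity of v' is assumed: a derivative is measurable, and the exponential dominates it.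
  have hvint : IntervalIntegrable (deriv v) volume 0 t := by
    rw [intervalIntegrable_iff_integrableOn_Ioc_of_le ht] at hBint ⊢
    exact hBint.mono' (measurable_deriv v).aestronglyMeasurable hae
  have hFTC := integral_eq_of_hasDerivAt_off_countable_of_le v (deriv v) ht hC hv
    (fun s hs => by rw [(hd s hs).deriv]; exact hd s hs) hvint
  have hle := intervalIntegral.norm_integral_le_of_norm_le ht
    ((ae_restrict_iff' measurableSet_Ioc).1 hae) hBint
  rw [hFTC, intervalIntegral.integral_eq_sub_of_hasDerivAt (fun s _ => hB s) hBint] at hle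
  refine hle.trans ?_
  have : 0 ≤ K / μ * Real.exp (-μ * (t - 0)) := by positivity
  simp only [sub_self, mul_zero, Real.exp_zero, mul_one]
  linarith

theorem IsTimeSeq.pos_of_mem_regularTimes {τ : ℕ → ℝ} (hτ : IsTimeSeq τ) {t : ℝ}
    (ht : t ∈ regularTimes τ) : 0 < t :=
  lt_of_le_of_ne ht.1 fun h0 => ht.2 ⟨0, hτ.2.1.trans h0⟩

/-- Since τ_i → ∞, the times form a locally finite, hence closed, set; since τ₀ = 0, the end point
of the half-line is removed too. -/
theorem isOpen_regularTimes {τ : ℕ → ℝ} (hτ : IsTimeSeq τ) : IsOpen (regularTimes τ) := by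
  have hc : IsClosed (range τ) := by
    rw [← iUnion_singleton_eq_range]
    refine LocallyFinite.isClosed_iUnion (fun x => ⟨Iio (x + 1), Iio_mem_nhds (by linarith), ?_⟩)
      fun _ => isClosed_singleton
    obtain ⟨N, hN⟩ := (hτ.2.2.eventually_ge_atTop (x + 1)).exists_forall_of_atTop
    refine (finite_lt_nat N).subset fun i hi => ?_
    obtain ⟨y, rfl, hy⟩ := hi
    by_contra h
    exact absurd (hN i (not_lt.1 h)) (not_le.2 hy)
  have e : regularTimes τ = Ioi 0 \ range τ := by
    ext t
    exact ⟨fun h => ⟨hτ.pos_of_mem_regularTimes h, h.2⟩, fun h => ⟨Ioi_subset_Ici_self h.1, h.2⟩⟩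
  rw [e]
  exact isOpen_Ioi.sdiff hc

theorem IsTimeSeq.Ioo_subset_regularTimes {τ : ℕ → ℝ} (hτ : IsTimeSeq τ) (i : ℕ) :
    Ioo (τ i) (τ (i + 1)) ⊆ regularTimes τ := by
  intro t ht
  have h0 : 0 ≤ τ i := hτ.2.1 ▸ hτ.1.monotone (Nat.zero_le i)
  refine ⟨h0.trans ht.1.le, ?_⟩
  rintro ⟨j, rfl⟩
  have h1 := hτ.1.lt_iff_lt.1 ht.1
  have h2 := hτ.1.lt_iff_lt.1 ht.2
  omega

/-- Differentiation of a Fourier sine integral with respect to a parameter. -/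
theorem hasDerivAt_sinCoeff {U : Set ℝ} (hU : IsOpen U) {u : ℝ → ℝ → ℝ}
    (hu : ContDiffOn ℝ 1 (fun z : ℝ × ℝ => u z.1 z.2) (U ×ˢ Icc 0 1)) {t : ℝ} (ht : t ∈ U)
    (n : ℕ) :
    HasDerivAt (fun s => sinCoeff (u s) n)
      (sinCoeff (fun x => deriv (fun t' => u t' x) t) n) t ∧
    ContinuousOn (fun x => deriv (fun t' => u t' x) t) (Icc 0 1) := by
  set S := U ×ˢ Icc (0 : ℝ) 1 with hS
  set D : ℝ × ℝ → ℝ := fun z => fderivWithin ℝ (fun z : ℝ × ℝ => u z.1 z.2) S z (1, 0) with hD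
  have hSu : UniqueDiffOn ℝ S := hU.uniqueDiffOn.prod (uniqueDiffOn_Icc zero_lt_one)
  have hDc : ContinuousOn D S :=
    (hu.continuousOn_fderivWithin hSu le_rfl).clm_apply continuousOn_const
  have hder : ∀ s ∈ U, ∀ x ∈ Icc (0 : ℝ) 1, HasDerivAt (fun t' => u t' x) (D (s, x)) s := by
    intro s hs x hx
    have h1 := (hu.differentiableOn one_ne_zero (s, x) ⟨hs, hx⟩).hasFDerivWithinAt
    have h2 : HasDerivWithinAt (fun t' : ℝ => (t', x)) ((1 : ℝ), (0 : ℝ)) U s :=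
      ((hasDerivAt_id s).prodMk (hasDerivAt_const s x)).hasDerivWithinAt
    have h3 := h1.comp_hasDerivWithinAt s h2 (fun t' ht' => mk_mem_prod ht' hx)
    exact h3.hasDerivAt (hU.mem_nhds hs)
  have hsec : ∀ s ∈ U, ContinuousOn (fun x => D (s, x)) (Icc 0 1) := fun s hs =>
    hDc.comp (by fun_prop) fun x hx => ⟨hs, hx⟩
  have husec : ∀ s ∈ U, ContinuousOn (u s) (Icc 0 1) := fun s hs =>
    hu.continuousOn.comp (f := fun x => (s, x)) (by fun_prop) fun x hx => ⟨hs, hx⟩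
  -- The time derivative is continuous up to x = 0 and x = 1, so compactness of a closed ball times
  -- [0,1] supplies a constant dominating function.
  obtain ⟨ε, hε, hball⟩ := Metric.nhds_basis_closedBall.mem_iff.1 (hU.mem_nhds ht)
  obtain ⟨M, hM⟩ := ((isCompact_closedBall t ε).prod
    (isCompact_Icc (a := (0 : ℝ)) (b := 1))).exists_bound_of_continuousOn
    (hDc.mono (prod_mono_left hball))
  have hIoc : uIoc (0 : ℝ) 1 ⊆ Icc 0 1 := by
    rw [uIoc_of_le zero_le_one]; exact Ioc_subset_Icc_self
  have key := intervalIntegral.hasDerivAt_integral_of_dominated_loc_of_deriv_le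
    (μ := volume) (a := 0) (b := 1) (x₀ := t) (s := Metric.closedBall t ε) (bound := fun _ => M)
    (F := fun s x => u s x * Real.sin (n * Real.pi * x))
    (F' := fun s x => D (s, x) * Real.sin (n * Real.pi * x))
    (Metric.closedBall_mem_nhds t hε)
    (by
      filter_upwards [hU.mem_nhds ht] with s hs
      exact (((husec s hs).mono hIoc).mul (by fun_prop)).aestronglyMeasurable
        measurableSet_uIoc)
    (ContinuousOn.intervalIntegrable (by
      rw [uIcc_of_le zero_le_one]
      exact (husec t ht).mul (by fun_prop)))
    ((((hsec t ht).mono hIoc).mul (by fun_prop)).aestronglyMeasurable measurableSet_uIoc)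
    (Eventually.of_forall fun x hx s hs => by
      rw [norm_mul]
      calc ‖D (s, x)‖ * ‖Real.sin (n * Real.pi * x)‖ ≤ ‖D (s, x)‖ * 1 :=
            mul_le_mul_of_nonneg_left (Real.abs_sin_le_one _) (norm_nonneg _)
        _ ≤ M := by rw [mul_one]; exact hM (s, x) ⟨hs, hIoc hx⟩)
    intervalIntegrable_const
    (Eventually.of_forall fun x hx s hs => (hder s (hball hs) x (hIoc hx)).mul_const _)
  refine ⟨key.2.congr_deriv ?_, (hsec t ht).congr fun x hx => (hder t ht x hx).deriv⟩
  exact integral_zero_one_congr fun x hx => by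
    simp only [(hder t ht x (Ioo_subset_Icc_self hx)).deriv]

/-! ### The Dirichlet operator on sine integrals -/

/-- The first two derivatives on `[0,1]` of a function of class `C²`. -/
theorem hasDerivWithinAt_of_contDiffOn_two {g : ℝ → ℝ} (hg : ContDiffOn ℝ 2 g (Icc 0 1)) :
    (∀ x ∈ Icc (0 : ℝ) 1, HasDerivWithinAt g (derivWithin g (Icc 0 1) x) (Icc 0 1) x) ∧
    (∀ x ∈ Icc (0 : ℝ) 1, HasDerivWithinAt (derivWithin g (Icc 0 1))
      (derivWithin (derivWithin g (Icc 0 1)) (Icc 0 1) x) (Icc 0 1) x) ∧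
    ContinuousOn (derivWithin g (Icc 0 1)) (Icc 0 1) ∧
    ContinuousOn (derivWithin (derivWithin g (Icc 0 1)) (Icc 0 1)) (Icc 0 1) := by
  have hI : UniqueDiffOn ℝ (Icc (0 : ℝ) 1) := uniqueDiffOn_Icc zero_lt_one
  have h1 : ContDiffOn ℝ 1 (derivWithin g (Icc 0 1)) (Icc 0 1) :=
    hg.derivWithin hI (by norm_num)
  have h2 : ContDiffOn ℝ 0 (derivWithin (derivWithin g (Icc 0 1)) (Icc 0 1)) (Icc 0 1) :=
    h1.derivWithin hI (by norm_num)
  exact ⟨fun x hx => (hg.differentiableOn (by norm_num) x hx).hasDerivWithinAt,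
    fun x hx => (h1.differentiableOn (by norm_num) x hx).hasDerivWithinAt,
    h1.continuousOn, h2.continuousOn⟩

theorem dirichletOp_apply {p q : ℝ} (hp : 0 < p) {g : ℝ → ℝ} (hg : ContDiffOn ℝ 2 g (Icc 0 1))
    {x : ℝ} (hx : x ∈ Icc (0 : ℝ) 1) :
    (dirichletOp p q hp).apply g x =
      -p * derivWithin (derivWithin g (Icc 0 1)) (Icc 0 1) x + q * g x := by
  have h := ((hasDerivWithinAt_of_contDiffOn_two hg).2.1 x hx).const_mul p
  simp only [SLOperator.apply, dirichletOp]
  rw [h.derivWithin (uniqueDiffOn_Icc zero_lt_one x hx)]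
  ring

/-- The sine integrals of `A g`, for `g` that satisfies the Dirichlet conditions. -/
theorem sinCoeff_dirichletOp_apply {p q : ℝ} (hp : 0 < p) {g : ℝ → ℝ}
    (hg : ContDiffOn ℝ 2 g (Icc 0 1)) (h0 : g 0 = 0) (h1 : g 1 = 0) (n : ℕ) :
    sinCoeff ((dirichletOp p q hp).apply g) n =
      (p * (n * Real.pi) ^ 2 + q) * sinCoeff g n := by
  obtain ⟨d1, d2, c1, c2⟩ := hasDerivWithinAt_of_contDiffOn_two hg
  rw [sinCoeff_congr (fun x hx => dirichletOp_apply hp hg (Ioo_subset_Icc_self hx)),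
    sinCoeff_add ((memL2_of_continuousOn c2).const_mul _)
      ((memL2_of_continuousOn hg.continuousOn).const_mul _), sinCoeff_const_mul,
    sinCoeff_const_mul, sinCoeff_deriv n d2 c2, cosCoeff_deriv n d1 c1 h1, h0]
  ring

/-! ### Modal equations of the solution -/

section Solution

variable {p q : ℝ} {hp : 0 < p} {τ : ℕ → ℝ} {f : ℝ → ℝ → ℝ} {u₀ : ℝ → ℝ} {u : ℝ → ℝ → ℝ}

/-- The boundary conditions are imposed only at regular times; at τ_i they follow from the left
limits of u. -/
theorem IsSolution.dirichlet (hτ : IsTimeSeq τ)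
    (hu : IsSolution (dirichletOp p q hp) τ f (fun _ => 0) (fun _ => 0) u₀ u) {t : ℝ}
    (ht : 0 < t) : u t 0 = 0 ∧ u t 1 = 0 := by
  have hreg : ∀ s ∈ regularTimes τ, u s 0 = 0 ∧ u s 1 = 0 := fun s hs => by
    have h0 := hu.bc0 s hs
    have h1 := hu.bc1 s hs
    simp only [SLOperator.bdry0, SLOperator.bdry1, dirichletOp] at h0 h1
    constructor <;> linarith
  by_cases h : t ∈ range τ
  · obtain ⟨i, rfl⟩ := h
    obtain ⟨j, rfl⟩ : ∃ j, i = j + 1 := Nat.exists_eq_succ_of_ne_zero fun h => by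
      rw [h, hτ.2.1] at ht
      exact lt_irrefl _ ht
    have hev : ∀ᶠ s in 𝓝[<] τ (j + 1), s ∈ regularTimes τ := by
      filter_upwards [Ioo_mem_nhdsLT (hτ.1 (Nat.lt_succ_self j))] with s hs
      exact hτ.Ioo_subset_regularTimes j hs
    constructor
    · exact tendsto_nhds_unique_of_eventuallyEq (hu.lim_u (j + 1) (by omega) 0 (by simp))
        tendsto_const_nhds (hev.mono fun s hs => (hreg s hs).1)
    · exact tendsto_nhds_unique_of_eventuallyEq (hu.lim_u (j + 1) (by omega) 1 (by simp))
        tendsto_const_nhds (hev.mono fun s hs => (hreg s hs).2)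
  · exact hreg t ⟨ht.le, h⟩

/-- By Parseval a single coefficient is dominated by the L² norm. Continuity thus holds at 0 and at
the τ_i too, where u need not be differentiable in time. -/
theorem IsSolution.continuousOn_sinCoeff
    (hu : IsSolution (dirichletOp p q hp) τ f (fun _ => 0) (fun _ => 0) u₀ u) (n : ℕ) :
    ContinuousOn (fun s => sinCoeff (u s) (n + 1)) (Ici 0) := by
  intro t ht
  have h := hu.contL2 t ht
  rw [ContinuousWithinAt, tendsto_iff_dist_tendsto_zero]
  refine squeeze_zero' (Eventually.of_forall fun _ => dist_nonneg) ?_ h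
  filter_upwards [self_mem_nhdsWithin] with s hs
  have hs2 : MemL2 (fun x => u s x - u t x) := (hu.memL2 s hs).sub (hu.memL2 t ht)
  have hle := le_hasSum (hasSum_sinCoeff_sq hs2) n fun m _ => by positivity
  rw [sinCoeff_sub (hu.memL2 s hs) (hu.memL2 t ht)] at hle
  have hw : weightedNorm (dirichletOp p q hp).r (fun x => u s x - u t x) =
      l2norm fun x => u s x - u t x := by simp [weightedNorm, l2norm, dirichletOp]
  rw [hw, Real.dist_eq]
  refine abs_le_of_sq_le_sq ?_ (l2norm_nonneg _)
  nlinarith [sq_nonneg (sinCoeff (u s) (n + 1) - sinCoeff (u t) (n + 1))]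

/-- Testing the equation with sin(nπx) decouples the modes; the Dirichlet conditions cancel the
boundary terms. -/
theorem IsSolution.hasDerivAt_sinCoeff (hτ : IsTimeSeq τ)
    (hf : ∀ t, 0 ≤ t → ContDiffOn ℝ 1 (f t) (Icc 0 1))
    (hu : IsSolution (dirichletOp p q hp) τ f (fun _ => 0) (fun _ => 0) u₀ u) {t : ℝ}
    (ht : t ∈ regularTimes τ) (n : ℕ) :
    HasDerivAt (fun s => sinCoeff (u s) n)
      (-(p * (n * Real.pi) ^ 2 + q) * sinCoeff (u t) n + sinCoeff (f t) n) t := by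
  have ht0 : 0 < t := hτ.pos_of_mem_regularTimes ht
  obtain ⟨hd, hc⟩ := ParabolicSL.hasDerivAt_sinCoeff (isOpen_regularTimes hτ) hu.contDiff ht n
  refine hd.congr_deriv ?_
  have hA : ∀ x ∈ Ioo (0 : ℝ) 1, (dirichletOp p q hp).apply (u t) x =
      f t x - deriv (fun t' => u t' x) t := fun x hx => by linarith [hu.pde t ht x hx]
  have hb := hu.dirichlet hτ ht0
  have h := sinCoeff_dirichletOp_apply (q := q) hp (hu.profile t ht0) hb.1 hb.2 n
  rw [sinCoeff_congr hA, sinCoeff_sub (memL2_of_continuousOn (hf t ht.1).continuousOn)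
    (memL2_of_continuousOn hc)] at h
  linarith

/-- The `n`-th eigenvalue (counted from `0`) of the Dirichlet operator. -/
noncomputable def eigenvalue (p q : ℝ) (n : ℕ) : ℝ := p * ((n + 1 : ℕ) * Real.pi) ^ 2 + q

/-- An estimate of a linear combination of sine integrals of the solution, from the variation of
constants formula. -/
theorem IsSolution.abs_sum_le (hτ : IsTimeSeq τ)
    (hf : ∀ t, 0 ≤ t → ContDiffOn ℝ 1 (f t) (Icc 0 1))
    (hu : IsSolution (dirichletOp p q hp) τ f (fun _ => 0) (fun _ => 0) u₀ u) {t : ℝ}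
    (ht : 0 < t) (I : Finset ℕ) (c : ℕ → ℝ) {K μ : ℝ} (hK : 0 ≤ K) (hμ : 0 < μ)
    (hb : ∀ s ∈ Ioo 0 t, |∑ n ∈ I, c n *
      (Real.exp (-eigenvalue p q n * (t - s)) * sinCoeff (f s) (n + 1))| ≤ K * Real.exp (-μ * (t - s))) :
    |∑ n ∈ I, c n * (sinCoeff (u t) (n + 1) -
      Real.exp (-eigenvalue p q n * t) * sinCoeff u₀ (n + 1))| ≤ K / μ := by
  -- With the integrating factor e^{-λ(t-s)} the terms in u cancel in v', which leaves the forcing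
  -- alone; v(t) - v(0) is the Duhamel term.
  set v : ℝ → ℝ := fun s => ∑ n ∈ I, c n *
    (Real.exp (-eigenvalue p q n * (t - s)) * sinCoeff (u s) (n + 1)) with hv
  have h := abs_sub_le_of_abs_deriv_le_exp (v := v) (countable_range τ) ht.le hK hμ
    (v' := fun s => ∑ n ∈ I, c n *
      (Real.exp (-eigenvalue p q n * (t - s)) * sinCoeff (f s) (n + 1)))
    (by
      refine continuousOn_finsetSum _ fun n _ => continuousOn_const.mul (ContinuousOn.mul
        (by fun_prop) ((hu.continuousOn_sinCoeff n).mono fun s hs => hs.1)))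
    (fun s hs => by
      refine HasDerivAt.fun_sum fun n _ => ?_
      have h1 := hu.hasDerivAt_sinCoeff hτ hf (t := s) ⟨hs.1.1.le, hs.2⟩ (n + 1)
      have h2 := (((hasDerivAt_id s).const_sub t).const_mul
        (-eigenvalue p q n)).exp
      refine ((h2.mul h1).const_mul (c n)).congr_deriv ?_
      simp only [id, eigenvalue]
      ring)
    (fun s hs => hb s hs.1)
  have e : v t - v 0 = ∑ n ∈ I, c n * (sinCoeff (u t) (n + 1) -
      Real.exp (-eigenvalue p q n * t) * sinCoeff u₀ (n + 1)) := by
    rw [hv, ← Finset.sum_sub_distrib]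
    refine Finset.sum_congr rfl fun n _ => ?_
    rw [sinCoeff_congr fun x hx => hu.init x (Ioo_subset_Icc_self hx)]
    simp only [sub_self, mul_zero, Real.exp_zero, one_mul, sub_zero]
    ring
  rwa [e] at h

end Solution

/-! ### Boundedness of the input norm on finite time intervals -/

/-- From |f|² ≤ 2(|f₁|² + |f₂|²). The term with Af₂ is dropped, but its continuity is needed for the
larger integrand to be integrable. -/
theorem IsGDOn.l2norm_bounded {p q : ℝ} {hp : 0 < p} {s T : ℝ} {f f₁ f₂ : ℝ → ℝ → ℝ}
    {a b c : ℝ → ℝ} (h : IsGDOn (dirichletOp p q hp) s T f f₁ f₂ a b c) :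
    ∃ M, ∀ t ∈ Ioo s T, l2norm (f t) ≤ M := by
  obtain ⟨M, hM⟩ := h.bound
  refine ⟨√(2 * M), fun t ht => Real.sqrt_le_sqrt ?_⟩
  have c1 := (h.f₁_pc1 t ht).continuousOn
  have hC := (h.f₂_dom t ht).1
  have c2 := hC.continuousOn
  have c3 : ContinuousOn ((dirichletOp p q hp).apply (f₂ t)) (Icc 0 1) := by
    have := (hasDerivWithinAt_of_contDiffOn_two hC).2.2.2
    exact ((continuousOn_const.mul this).add (continuousOn_const.mul c2)).congr
      fun x hx => dirichletOp_apply hp hC hx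
  have hle := hM t ht
  simp only [dirichletOp, one_mul] at hle
  refine le_trans ?_ (mul_le_mul_of_nonneg_left hle two_pos.le)
  rw [← intervalIntegral.integral_const_mul]
  have hu : uIcc (0 : ℝ) 1 = Icc 0 1 := uIcc_of_le zero_le_one
  refine intervalIntegral.integral_mono_on zero_le_one ?_ ?_ fun x hx => ?_
  · refine ContinuousOn.intervalIntegrable ?_
    rw [hu]
    exact (((c1.add c2).congr fun x hx => h.sum_eq t ht x hx).abs).pow 2
  · refine ContinuousOn.intervalIntegrable ?_
    rw [hu]
    exact continuousOn_const.mul (((c1.abs.pow 2).add (c2.abs.pow 2)).add (c3.abs.pow 2))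
  · rw [h.sum_eq t ht x hx]
    simp only [sq_abs]
    nlinarith [sq_nonneg (f₁ t x - f₂ t x), sq_nonneg ((dirichletOp p q hp).apply (f₂ t) x)]

theorem IsGDWith.l2norm_bounded {p q : ℝ} {hp : 0 < p} {τ : ℕ → ℝ} {f : ℝ → ℝ → ℝ}
    (h : IsGDWith (dirichletOp p q hp) τ f) (t : ℝ) :
    ∃ M, ∀ s ∈ Ioo 0 t, l2norm (f s) ≤ M := by
  have hk : ∀ k, ∃ M, ∀ s ∈ Ioo 0 (τ k), l2norm (f s) ≤ M := by
    intro k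
    induction k with
    | zero => exact ⟨0, fun s hs => absurd (hs.1.trans hs.2) (by rw [h.1.2.1]; exact lt_irrefl _)⟩
    | succ k ih =>
      obtain ⟨M₁, h₁⟩ := ih
      obtain ⟨f₁, f₂, a, b, c, hi⟩ := h.2 k
      obtain ⟨M₂, h₂⟩ := hi.l2norm_bounded
      -- The open strips miss the time τ_k itself, whose norm is added separately.
      refine ⟨max (max M₁ M₂) (l2norm (f (τ k))), fun s hs => ?_⟩
      rcases lt_trichotomy s (τ k) with hlt | rfl | hgt
      · exact (h₁ s ⟨hs.1, hlt⟩).trans ((le_max_left _ _).trans (le_max_left _ _))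
      · exact le_max_right _ _
      · exact (h₂ s ⟨hgt, hs.2⟩).trans ((le_max_right _ _).trans (le_max_left _ _))
  obtain ⟨k, htk⟩ := (h.1.2.2.eventually_ge_atTop t).exists
  obtain ⟨M, hM⟩ := hk k
  exact ⟨M, fun s hs => hM s ⟨hs.1, hs.2.trans_le htk⟩⟩

/-! ### Estimates of the free and the forced part -/

/-- Minkowski's inequality for finite sums of squares. -/
theorem sum_add_sq_le {ι : Type*} (I : Finset ι) {x y : ι → ℝ} {X Y : ℝ} (hX : 0 ≤ X) (hY : 0 ≤ Y)
    (hx : ∑ n ∈ I, x n ^ 2 ≤ X ^ 2) (hy : ∑ n ∈ I, y n ^ 2 ≤ Y ^ 2) :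
    ∑ n ∈ I, (x n + y n) ^ 2 ≤ (X + Y) ^ 2 := by
  have hcs := Finset.sum_mul_sq_le_sq_mul_sq I x y
  have hxy : ∑ n ∈ I, x n * y n ≤ X * Y := by
    refine le_of_abs_le (abs_le_of_sq_le_sq (hcs.trans ?_) (by positivity))
    rw [mul_pow]
    exact mul_le_mul hx hy (Finset.sum_nonneg fun _ _ => sq_nonneg _) (sq_nonneg _)
  have e : ∑ n ∈ I, (x n + y n) ^ 2 =
      ∑ n ∈ I, x n ^ 2 + 2 * ∑ n ∈ I, x n * y n + ∑ n ∈ I, y n ^ 2 := by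
    rw [Finset.mul_sum, ← Finset.sum_add_distrib, ← Finset.sum_add_distrib]
    exact Finset.sum_congr rfl fun _ _ => by ring
  rw [e]
  linarith [hxy, hx, hy, add_sq X Y]

theorem le_eigenvalue {p : ℝ} (hp : 0 < p) (q : ℝ) (n : ℕ) :
    p * Real.pi ^ 2 + q ≤ eigenvalue p q n := by
  have h : (1 : ℝ) ≤ (n + 1 : ℕ) := by simp
  have : Real.pi ^ 2 ≤ ((n + 1 : ℕ) * Real.pi) ^ 2 := by
    rw [mul_pow]
    exact le_mul_of_one_le_left (by positivity) (one_le_pow₀ h)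
  unfold eigenvalue
  gcongr

/-- Bessel-type bound with coefficients that decay at least like the first mode. -/
theorem sum_exp_mul_sq_le {p : ℝ} (hp : 0 < p) (q : ℝ) {t X : ℝ} (ht : 0 ≤ t) (I : Finset ℕ)
    {c : ℕ → ℝ} (hc : ∑ n ∈ I, c n ^ 2 ≤ X ^ 2) :
    ∑ n ∈ I, (Real.exp (-eigenvalue p q n * t) * c n) ^ 2 ≤
      (Real.exp (-(p * Real.pi ^ 2 + q) * t) * X) ^ 2 := by
  rw [mul_pow]
  refine le_trans ?_ (mul_le_mul_of_nonneg_left hc (sq_nonneg _))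
  rw [Finset.mul_sum]
  refine Finset.sum_le_sum fun n _ => ?_
  rw [mul_pow]
  have h := le_eigenvalue hp q n
  gcongr

section Estimates

variable {p q : ℝ} {hp : 0 < p} {τ : ℕ → ℝ} {f : ℝ → ℝ → ℝ} {u₀ : ℝ → ℝ} {u : ℝ → ℝ → ℝ}
  {σ t S : ℝ}

/-- Passes to coefficients in the orthonormal basis, so that Minkowski and Cauchy-Schwarz apply to
plain sums of squares. -/
theorem sum_two_mul_eq (I : Finset ℕ) (c : ℕ → ℝ) :
    ∑ n ∈ I, 2 * c n ^ 2 = ∑ n ∈ I, (√2 * c n) ^ 2 :=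
  Finset.sum_congr rfl fun _ _ => by rw [mul_pow, Real.sq_sqrt two_pos.le]

theorem sum_sinCoeff_sq_le {g : ℝ → ℝ} (hg : MemL2 g) (I : Finset ℕ) :
    ∑ n ∈ I, (√2 * sinCoeff g (n + 1)) ^ 2 ≤ l2norm g ^ 2 := by
  rw [← sum_two_mul_eq]
  exact sum_le_hasSum I (fun n _ => by positivity) (hasSum_sinCoeff_sq hg)

/-- The sine coefficient of the part of the solution that the input generates. -/
noncomputable def forcedCoeff (p q : ℝ) (u₀ : ℝ → ℝ) (u : ℝ → ℝ → ℝ) (t : ℝ) (n : ℕ) : ℝ :=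
  √2 * (sinCoeff (u t) (n + 1) - Real.exp (-eigenvalue p q n * t) * sinCoeff u₀ (n + 1))

theorem sqrt_two_mul_sinCoeff_eq (n : ℕ) : √2 * sinCoeff (u t) (n + 1) =
    Real.exp (-eigenvalue p q n * t) * (√2 * sinCoeff u₀ (n + 1)) + forcedCoeff p q u₀ u t n := by
  unfold forcedCoeff
  ring

/-- Variation of constants for one mode. Keeping its own rate λ_n instead of λ₁ gives the decay in n
that the estimate of u' needs. -/
theorem abs_forcedCoeff_le (hτ : IsTimeSeq τ) (hf : ∀ t, 0 ≤ t → ContDiffOn ℝ 1 (f t) (Icc 0 1))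
    (hu : IsSolution (dirichletOp p q hp) τ f (fun _ => 0) (fun _ => 0) u₀ u)
    (hσ : σ < p * Real.pi ^ 2 + q) (ht : 0 < t) (hS : 0 ≤ S)
    (hfS : ∀ s ∈ Ioo 0 t, l2norm (f s) ≤ S * Real.exp (σ * (t - s))) (n : ℕ) :
    |forcedCoeff p q u₀ u t n| ≤ S / (eigenvalue p q n - σ) := by
  have hμ : 0 < eigenvalue p q n - σ := by linarith [le_eigenvalue hp q n]
  have h := hu.abs_sum_le hτ hf ht {n} (fun _ => √2) hS hμ (fun s hs => ?_)
  · simpa only [Finset.sum_singleton, forcedCoeff] using h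
  · rw [Finset.sum_singleton]
    have hB := sum_sinCoeff_sq_le (memL2_of_continuousOn (hf s hs.1.le).continuousOn) {n}
    rw [Finset.sum_singleton] at hB
    have hB' := abs_le_of_sq_le_sq hB (l2norm_nonneg _)
    calc |√2 * (Real.exp (-eigenvalue p q n * (t - s)) * sinCoeff (f s) (n + 1))|
        = Real.exp (-eigenvalue p q n * (t - s)) * |√2 * sinCoeff (f s) (n + 1)| := by
          rw [mul_left_comm, abs_mul, Real.abs_exp]
      _ ≤ Real.exp (-eigenvalue p q n * (t - s)) * (S * Real.exp (σ * (t - s))) := by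
          gcongr
          exact hB'.trans (hfS s hs)
      _ = S * Real.exp (-(eigenvalue p q n - σ) * (t - s)) := by
          rw [mul_left_comm, ← Real.exp_add]
          congr 2
          ring

/-- Duality: weighting the modes with the forced coefficients themselves turns the combination into
their square sum Y, while Cauchy-Schwarz bounds the integrand by √Y S e^{-(λ₁-σ)(t-s)}. Hence Y ≤ √Y
S/(λ₁ - σ). -/
theorem sum_forcedCoeff_sq_le (hτ : IsTimeSeq τ)
    (hf : ∀ t, 0 ≤ t → ContDiffOn ℝ 1 (f t) (Icc 0 1))
    (hu : IsSolution (dirichletOp p q hp) τ f (fun _ => 0) (fun _ => 0) u₀ u)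
    (hσ : σ < p * Real.pi ^ 2 + q) (ht : 0 < t) (hS : 0 ≤ S)
    (hfS : ∀ s ∈ Ioo 0 t, l2norm (f s) ≤ S * Real.exp (σ * (t - s))) (I : Finset ℕ) :
    ∑ n ∈ I, forcedCoeff p q u₀ u t n ^ 2 ≤ (S / (p * Real.pi ^ 2 + q - σ)) ^ 2 := by
  set Y := ∑ n ∈ I, forcedCoeff p q u₀ u t n ^ 2 with hY
  have hY0 : 0 ≤ Y := Finset.sum_nonneg fun _ _ => sq_nonneg _
  have hμ : 0 < p * Real.pi ^ 2 + q - σ := by linarith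
  have h := hu.abs_sum_le hτ hf ht I (fun n => √2 * forcedCoeff p q u₀ u t n)
    (K := √Y * S) (by positivity) hμ (fun s hs => ?_)
  · have e : ∑ n ∈ I, √2 * forcedCoeff p q u₀ u t n * (sinCoeff (u t) (n + 1) -
        Real.exp (-eigenvalue p q n * t) * sinCoeff u₀ (n + 1)) = Y :=
      Finset.sum_congr rfl fun n _ => by
        rw [forcedCoeff]
        ring
    have h' := (le_abs_self _).trans h
    rw [e] at h'
    have hsq := Real.mul_self_sqrt hY0
    -- Dividing by √Y requires Y > 0.
    rcases hY0.eq_or_lt with h0 | h0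
    · rw [← h0]
      positivity
    · have hpos := Real.sqrt_pos.2 h0
      have : √Y ≤ S / (p * Real.pi ^ 2 + q - σ) := by
        refine le_of_mul_le_mul_left ?_ hpos
        rw [hsq, ← mul_div_assoc]
        exact h'
      calc Y = √Y ^ 2 := by rw [sq, hsq]
        _ ≤ _ := by gcongr
  · have hB := sum_exp_mul_sq_le hp q (sub_nonneg.2 hs.2.le) I
      (sum_sinCoeff_sq_le (memL2_of_continuousOn (hf s hs.1.le).continuousOn) I)
    have hcs := Finset.sum_mul_sq_le_sq_mul_sq I (fun n => forcedCoeff p q u₀ u t n)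
      (fun n => Real.exp (-eigenvalue p q n * (t - s)) * (√2 * sinCoeff (f s) (n + 1)))
    have e : ∑ n ∈ I, √2 * forcedCoeff p q u₀ u t n *
        (Real.exp (-eigenvalue p q n * (t - s)) * sinCoeff (f s) (n + 1)) =
        ∑ n ∈ I, forcedCoeff p q u₀ u t n *
          (Real.exp (-eigenvalue p q n * (t - s)) * (√2 * sinCoeff (f s) (n + 1))) :=
      Finset.sum_congr rfl fun n _ => by ring
    rw [e]
    have hle : |∑ n ∈ I, forcedCoeff p q u₀ u t n *
        (Real.exp (-eigenvalue p q n * (t - s)) * (√2 * sinCoeff (f s) (n + 1)))| ≤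
        √Y * (Real.exp (-(p * Real.pi ^ 2 + q) * (t - s)) * l2norm (f s)) := by
      refine abs_le_of_sq_le_sq (hcs.trans ?_)
        (mul_nonneg (Real.sqrt_nonneg _) (mul_nonneg (Real.exp_pos _).le (l2norm_nonneg _)))
      rw [mul_pow, Real.sq_sqrt hY0]
      exact mul_le_mul_of_nonneg_left hB hY0
    refine hle.trans ?_
    calc √Y * (Real.exp (-(p * Real.pi ^ 2 + q) * (t - s)) * l2norm (f s))
        ≤ √Y * (Real.exp (-(p * Real.pi ^ 2 + q) * (t - s)) * (S * Real.exp (σ * (t - s)))) := by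
          gcongr
          exact hfS s hs
      _ = √Y * S * Real.exp (-(p * Real.pi ^ 2 + q - σ) * (t - s)) := by
          rw [mul_left_comm _ S, ← Real.exp_add, mul_assoc]
          congr 3
          ring

/-- The function λ/(λ - σ) decreases in λ when σ ≥ 0, so its value at λ₁ can be taken out of the
sum; what remains is the sum behind the gain at q/p. -/
theorem sum_mul_forcedCoeff_sq_le (hq : -p * Real.pi ^ 2 < q) (hτ : IsTimeSeq τ)
    (hf : ∀ t, 0 ≤ t → ContDiffOn ℝ 1 (f t) (Icc 0 1))
    (hu : IsSolution (dirichletOp p q hp) τ f (fun _ => 0) (fun _ => 0) u₀ u)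
    (hσ0 : 0 ≤ σ) (hσ : σ < p * Real.pi ^ 2 + q) (ht : 0 < t) (hS : 0 ≤ S)
    (hfS : ∀ s ∈ Ioo 0 t, l2norm (f s) ≤ S * Real.exp (σ * (t - s))) (I : Finset ℕ) :
    ∑ n ∈ I, ((n + 1 : ℕ) * Real.pi * forcedCoeff p q u₀ u t n) ^ 2 ≤
      ((p * Real.pi ^ 2 + q) / (p * Real.pi ^ 2 + q - σ) * p⁻¹ * gain (q / p) * S) ^ 2 := by
  have hμ : 0 < p * Real.pi ^ 2 + q - σ := by linarith
  have hs : -Real.pi ^ 2 < q / p := by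
    rw [lt_div_iff₀ hp]
    linarith
  have hterm : ∀ n : ℕ, ((n + 1 : ℕ) * Real.pi * forcedCoeff p q u₀ u t n) ^ 2 ≤
      ((p * Real.pi ^ 2 + q) / (p * Real.pi ^ 2 + q - σ) * p⁻¹ * S) ^ 2 *
        ((n + 1 : ℕ) * Real.pi / (((n + 1 : ℕ) * Real.pi) ^ 2 + q / p)) ^ 2 := by
    intro n
    have hle := le_eigenvalue hp q n
    have h := abs_forcedCoeff_le hτ hf hu hσ ht hS hfS n
    have hdiv : S / (eigenvalue p q n - σ) ≤
        (p * Real.pi ^ 2 + q) / (p * Real.pi ^ 2 + q - σ) * S / eigenvalue p q n := by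
      rw [div_mul_eq_mul_div, div_div, div_le_div_iff₀ (by linarith)
        (mul_pos hμ (by linarith))]
      -- After clearing denominators the claim is Sσ(λ_n - λ₁) ≥ 0.
      nlinarith [mul_nonneg (mul_nonneg hS hσ0) (sub_nonneg.2 hle)]
    have he : ((n + 1 : ℕ) * Real.pi) ^ 2 + q / p = eigenvalue p q n / p := by
      rw [eigenvalue]
      field_simp
    rw [he, ← mul_pow, ← sq_abs]
    refine pow_le_pow_left₀ (abs_nonneg _) ?_ 2
    rw [abs_mul, abs_of_nonneg (show 0 ≤ ((n + 1 : ℕ) : ℝ) * Real.pi by positivity)]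
    calc ((n + 1 : ℕ) : ℝ) * Real.pi * |forcedCoeff p q u₀ u t n|
        ≤ (n + 1 : ℕ) * Real.pi *
          ((p * Real.pi ^ 2 + q) / (p * Real.pi ^ 2 + q - σ) * S / eigenvalue p q n) := by
          gcongr
          exact h.trans hdiv
      _ = _ := by
          have : eigenvalue p q n ≠ 0 := by linarith
          field_simp
  refine (Finset.sum_le_sum fun n _ => hterm n).trans ?_
  rw [← Finset.mul_sum, mul_right_comm _ (gain _) S, mul_pow _ (gain _)]
  exact mul_le_mul_of_nonneg_left (sum_le_gain_sq hs I) (sq_nonneg _)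

theorem l2norm_le_of_bound (hτ : IsTimeSeq τ)
    (hf : ∀ t, 0 ≤ t → ContDiffOn ℝ 1 (f t) (Icc 0 1)) (hu₀ : MemL2 u₀)
    (hu : IsSolution (dirichletOp p q hp) τ f (fun _ => 0) (fun _ => 0) u₀ u)
    (hσ : σ < p * Real.pi ^ 2 + q) (ht : 0 < t) (hS : 0 ≤ S)
    (hfS : ∀ s ∈ Ioo 0 t, l2norm (f s) ≤ S * Real.exp (σ * (t - s))) :
    l2norm (u t) ≤ Real.exp (-(p * Real.pi ^ 2 + q) * t) * l2norm u₀
      + S / (p * Real.pi ^ 2 + q - σ) := by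
  have hμ : 0 < p * Real.pi ^ 2 + q - σ := by linarith
  have hX : 0 ≤ Real.exp (-(p * Real.pi ^ 2 + q) * t) * l2norm u₀ :=
    mul_nonneg (Real.exp_pos _).le (l2norm_nonneg _)
  have hY : 0 ≤ S / (p * Real.pi ^ 2 + q - σ) := by positivity
  refine (pow_le_pow_iff_left₀ (l2norm_nonneg _) (add_nonneg hX hY) two_ne_zero).1 ?_
  refine hasSum_le_of_sum_le (hasSum_sinCoeff_sq (hu.memL2 t ht.le)) fun I => ?_
  rw [sum_two_mul_eq]
  simp only [sqrt_two_mul_sinCoeff_eq (p := p) (q := q) (u₀ := u₀)]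
  exact sum_add_sq_le I hX hY (sum_exp_mul_sq_le hp q ht.le I (sum_sinCoeff_sq_le hu₀ I))
    (sum_forcedCoeff_sq_le hτ hf hu hσ ht hS hfS I)

/-- Functions vanishing at both ends have derivatives of mean zero, whose cosine integrals are nπ
times the sine integrals of the function. This holds for u[t] and for the absolutely continuous u₀,
so the cosine Parseval identity applies to both. -/
theorem l2norm_spatialDeriv_le_of_bound (hq : -p * Real.pi ^ 2 < q) (hτ : IsTimeSeq τ)
    (hf : ∀ t, 0 ≤ t → ContDiffOn ℝ 1 (f t) (Icc 0 1)) (hu₀ : MemH1 u₀) (hu₀0 : u₀ 0 = 0)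
    (hu₀1 : u₀ 1 = 0)
    (hu : IsSolution (dirichletOp p q hp) τ f (fun _ => 0) (fun _ => 0) u₀ u)
    (hσ0 : 0 ≤ σ) (hσ : σ < p * Real.pi ^ 2 + q) (ht : 0 < t) (hS : 0 ≤ S)
    (hfS : ∀ s ∈ Ioo 0 t, l2norm (f s) ≤ S * Real.exp (σ * (t - s))) :
    l2norm (spatialDeriv u t) ≤ Real.exp (-(p * Real.pi ^ 2 + q) * t) * l2norm (deriv u₀)
      + (p * Real.pi ^ 2 + q) / (p * Real.pi ^ 2 + q - σ) * p⁻¹ * gain (q / p) * S := by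
  have hμ : 0 < p * Real.pi ^ 2 + q - σ := by linarith
  have hμ' : 0 < p * Real.pi ^ 2 + q := by linarith
  have hs : -Real.pi ^ 2 < q / p := by
    rw [lt_div_iff₀ hp]
    linarith
  have hg := gain_nonneg hs
  have hX : 0 ≤ Real.exp (-(p * Real.pi ^ 2 + q) * t) * l2norm (deriv u₀) :=
    mul_nonneg (Real.exp_pos _).le (l2norm_nonneg _)
  have hY : 0 ≤ (p * Real.pi ^ 2 + q) / (p * Real.pi ^ 2 + q - σ) * p⁻¹ * gain (q / p) * S := by
    positivity
  obtain ⟨d1, -, c1, -⟩ := hasDerivWithinAt_of_contDiffOn_two (hu.profile t ht)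
  obtain ⟨hb0, hb1⟩ := hu.dirichlet hτ ht
  have hcos : ∀ n, cosCoeff (spatialDeriv u t) n = n * Real.pi * sinCoeff (u t) n := fun n => by
    have := cosCoeff_deriv n d1 c1 hb1
    rw [hb0, neg_zero, zero_add] at this
    exact this
  have hcos₀ := fun n => cosCoeff_deriv_of_absolutelyContinuous n hu₀.1 hu₀0 hu₀1
  have hB : ∀ I : Finset ℕ, ∑ n ∈ I, ((n + 1 : ℕ) * Real.pi * (√2 * sinCoeff u₀ (n + 1))) ^ 2 ≤
      l2norm (deriv u₀) ^ 2 := fun I => by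
    have h := sum_le_hasSum I (fun n _ => by positivity)
      (hasSum_cosCoeff_sq hu₀.2 (by rw [hcos₀]; simp))
    rw [sum_two_mul_eq] at h
    simp only [hcos₀, mul_left_comm (√2)] at h
    exact h
  refine (pow_le_pow_iff_left₀ (l2norm_nonneg _) (add_nonneg hX hY) two_ne_zero).1 ?_
  refine hasSum_le_of_sum_le (hasSum_cosCoeff_sq (memL2_of_continuousOn c1)
    ((hcos 0).trans (by simp))) fun I => ?_
  rw [sum_two_mul_eq]
  have e : ∀ n : ℕ, √2 * cosCoeff (spatialDeriv u t) (n + 1) =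
      Real.exp (-eigenvalue p q n * t) * ((n + 1 : ℕ) * Real.pi * (√2 * sinCoeff u₀ (n + 1))) +
        (n + 1 : ℕ) * Real.pi * forcedCoeff p q u₀ u t n := fun n => by
    rw [hcos, forcedCoeff]
    ring
  have hsum := sum_add_sq_le I hX hY (sum_exp_mul_sq_le hp q ht.le I (hB I))
    (sum_mul_forcedCoeff_sq_le hq hτ hf hu hσ0 hσ ht hS hfS I)
  simp only [← e] at hsum
  exact hsum

end Estimates

end ParabolicSL

/-! ### The theorem -/

open ParabolicSL in
theorem theorem2p7 (p q : ℝ) (hp : 0 < p) (hq : -p * Real.pi ^ 2 < q)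
    (u₀ : ℝ → ℝ) (hu₀ : MemH1 u₀) (hu₀0 : u₀ 0 = 0) (hu₀1 : u₀ 1 = 0)
    (τ : ℕ → ℝ) (f : ℝ → ℝ → ℝ) (hf : IsGDWith (dirichletOp p q hp) τ f)
    (hfC1 : ∀ t, 0 ≤ t → ContDiffOn ℝ 1 (f t) (Set.Icc 0 1))
    (hf' : IsGD (dirichletOp p q hp) (spatialDeriv f) ∨ IsGD (neumannOp p q hp) (spatialDeriv f))
    (hf0 : IsGB (fun t => f t 0)) (hf1 : IsGB (fun t => f t 1))
    (u : ℝ → ℝ → ℝ)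
    (hu : IsSolution (dirichletOp p q hp) τ f (fun _ => 0) (fun _ => 0) u₀ u)
    (σ : ℝ) (hσ : σ ∈ Set.Ico 0 (p * Real.pi ^ 2 + q)) (t : ℝ) (ht : 0 < t) :
    BddAbove (fadingValues f σ t) ∧
    l2norm (u t) ≤ Real.exp (-(p * Real.pi ^ 2 + q) * t) * l2norm u₀
      + 1 / (p * Real.pi ^ 2 + q - σ) * sSup (fadingValues f σ t) ∧
    l2norm (spatialDeriv u t) ≤ Real.exp (-(p * Real.pi ^ 2 + q) * t) * l2norm (deriv u₀)
      + (p * Real.pi ^ 2 + q) / (p * Real.pi ^ 2 + q - σ) * p⁻¹ * gain (q / p)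
        * sSup (fadingValues f σ t) := by
  have hbdd : BddAbove (fadingValues f σ t) := by
    obtain ⟨M, hM⟩ := hf.l2norm_bounded t
    refine ⟨M, ?_⟩
    rintro _ ⟨s, hs, rfl⟩
    refine le_trans (mul_le_of_le_one_right (l2norm_nonneg _) (Real.exp_le_one_iff.2 ?_)) (hM s hs)
    nlinarith [mul_nonneg hσ.1 (sub_nonneg.2 hs.2.le)]
  have hS : 0 ≤ sSup (fadingValues f σ t) := by
    refine Real.sSup_nonneg ?_
    rintro _ ⟨s, -, rfl⟩
    exact mul_nonneg (l2norm_nonneg _) (Real.exp_pos _).le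
  -- Undoing the fading factor turns the supremum into the pointwise bound used by the estimates.
  have hfS : ∀ s ∈ Set.Ioo 0 t,
      l2norm (f s) ≤ sSup (fadingValues f σ t) * Real.exp (σ * (t - s)) := by
    intro s hs
    have h := mul_le_mul_of_nonneg_right (le_csSup hbdd (Set.mem_image_of_mem _ hs))
      (Real.exp_pos (σ * (t - s))).le
    rwa [mul_assoc, ← Real.exp_add, neg_mul, neg_add_cancel, Real.exp_zero, mul_one] at h
  have hu₀L2 : MemL2 u₀ := memL2_of_continuousOn <| by
    simpa only [Set.uIcc_of_le (zero_le_one (α := ℝ))] using hu₀.1.continuousOn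
  refine ⟨hbdd, ?_, l2norm_spatialDeriv_le_of_bound hq hf.1 hfC1 hu₀ hu₀0 hu₀1 hu hσ.1 hσ.2 ht
    hS hfS⟩
  rw [one_div_mul_eq_div]
  exact l2norm_le_of_bound hf.1 hfC1 hu₀L2 hu hσ.2 ht hS hfS
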